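/- Let $n\ge 2$ and let $M$ be a smooth $(n+1)$-dimensional manifold together with a diffeomorphism $\Phi$ from $M$ onto one of the three models $S^{n+1}\subset\mathbb{R}^{n+2}$, $\mathbb{R}^{n+1}$, $\mathbb{R}\times S^n$. The rotation group $SO(n+1)$ acts on $S^{n+1}$ by the rotations of $\mathbb{R}^{n+2}$ fixing the last basis vector, on $\mathbb{R}^{n+1}$ linearly, and on $\mathbb{R}\times S^n$ by rotating the factor $S^n$; via $\Phi$ it acts on $M$. A function or a Riemannian metric on $M$ is called rotationally symmetric if it is invariant under this action. Let $g$ be a complete, rotationally symmetric smooth Riemannian metric on $M$, let $\lambda>0$, and let $f\in C^\infty(M)$ satisfy the gradient shrinking soliton equation $$\mathrm{Rc}(g)+\nabla\nabla f-\lambda g=0 .$$ If $f$ is not rotationally symmetric, then the model is $\mathbb{R}^{n+1}$ (that is, it is neither $S^{n+1}$ nor $\mathbb{R}\times S^n$) and $g$ is the flat metric: $(M,g)$ is isometric to Euclidean space $\mathbb{R}^{n+1}$. -/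

import Mathlib

open scoped Manifold ContDiff Topology Bundle

noncomputable section

/-- Euclidean space `ℝᵏ`. -/
abbrev Euc (k : ℕ) : Type := EuclideanSpace ℝ (Fin k)

/-- The unit sphere `Sᵏ ⊆ ℝᵏ⁺¹`. -/
abbrev Sph (k : ℕ) : Type := Metric.sphere (0 : Euc (k + 1)) 1

section Riemannian

variable (m : ℕ) (M : Type*) [TopologicalSpace M] [ChartedSpace (Euc m) M]
  [IsManifold (𝓡 m) ∞ M]

/-- Smooth Riemannian metrics on a smooth `m`-manifold. -/
abbrev SmoothMetric : Type _ :=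
  Bundle.ContMDiffRiemannianMetric (𝓡 m) ∞ (Euc m) (fun x : M => TangentSpace (𝓡 m) x)

variable {m M}

/-- The partial derivative `∂ᵢ F` of a function on `ℝᵐ`. -/
def partialD (i : Fin m) (F : Euc m → ℝ) (y : Euc m) : ℝ :=
  fderiv ℝ F y (EuclideanSpace.single i (1 : ℝ))

/-- The coefficients `g(∂ᵢ, ∂ⱼ)` of a metric in the coordinates of a chart `φ`, as functions
of the coordinates. -/
def metricCoeff (g : SmoothMetric m M) (φ : OpenPartialHomeomorph M (Euc m)) (y : Euc m) :
    Matrix (Fin m) (Fin m) ℝ := fun i j =>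
  g.inner (φ.symm y)
    (mfderiv (𝓡 m) (𝓡 m) φ.symm y (EuclideanSpace.single i (1 : ℝ) : Euc m))
    (mfderiv (𝓡 m) (𝓡 m) φ.symm y (EuclideanSpace.single j (1 : ℝ) : Euc m))

/-- The Christoffel symbols
`Γᵏᵢⱼ = (1/2) ∑ₗ gᵏˡ (∂ᵢ gⱼₗ + ∂ⱼ gᵢₗ - ∂ₗ gᵢⱼ)` of the Levi-Civita connection in the chart `φ`. -/
def christoffel (g : SmoothMetric m M) (φ : OpenPartialHomeomorph M (Euc m)) (k i j : Fin m)
    (y : Euc m) : ℝ :=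
  (1 / 2 : ℝ) * ∑ l, (metricCoeff g φ y)⁻¹ k l *
    (partialD i (fun z => metricCoeff g φ z j l) y
      + partialD j (fun z => metricCoeff g φ z i l) y
      - partialD l (fun z => metricCoeff g φ z i j) y)

/-- The components of the Ricci tensor in the chart `φ`:
`Rcᵢⱼ = ∑ₖ (∂ₖ Γᵏᵢⱼ - ∂ⱼ Γᵏᵢₖ) + ∑ₖₗ (Γᵏₖₗ Γˡᵢⱼ - Γᵏⱼₗ Γˡᵢₖ)`. -/
def ricci (g : SmoothMetric m M) (φ : OpenPartialHomeomorph M (Euc m)) (i j : Fin m)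
    (y : Euc m) : ℝ :=
  ∑ k, (partialD k (christoffel g φ k i j) y - partialD j (christoffel g φ k i k) y)
    + ∑ k, ∑ l, (christoffel g φ k k l y * christoffel g φ l i j y
      - christoffel g φ k j l y * christoffel g φ l i k y)

/-- The components `∇ᵢ∇ⱼ f = ∂ᵢ∂ⱼ f - ∑ₖ Γᵏᵢⱼ ∂ₖ f` of the Hessian of `f` in the chart `φ`. -/
def hessian (g : SmoothMetric m M) (f : M → ℝ) (φ : OpenPartialHomeomorph M (Euc m)) (i j : Fin m)
    (y : Euc m) : ℝ :=
  partialD i (partialD j (f ∘ φ.symm)) y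
    - ∑ k, christoffel g φ k i j y * partialD k (f ∘ φ.symm) y

/-- `(g, f, lam)` is a shrinking gradient Ricci soliton structure on `M`: `lam > 0`, `f` is smooth
and `Rc(g) + ∇∇f - lam g = 0`. The equation is between tensors; it is written out in components,
in all smooth charts of `M` and at all points of them. -/
structure IsShrinkingSoliton (g : SmoothMetric m M) (f : M → ℝ) (lam : ℝ) : Prop where
  pos : 0 < lam
  smooth : ContMDiff (𝓡 m) 𝓘(ℝ, ℝ) ∞ f
  equation : ∀ φ ∈ IsManifold.maximalAtlas (𝓡 m) ∞ M, ∀ y ∈ φ.target, ∀ i j : Fin m,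
    ricci g φ i j y + hessian g f φ i j y - lam * metricCoeff g φ y i j = 0

/-- The distance of the metric `g`: the infimum of the `g`-lengths of `C¹` paths. -/
def metricDist (g : SmoothMetric m M) (x y : M) : ENNReal :=
  letI : Bundle.RiemannianBundle (fun x : M => TangentSpace (𝓡 m) x) := ⟨g.toRiemannianMetric⟩
  Manifold.riemannianEDist (𝓡 m) x y

/-- The metric `g` is complete: Cauchy sequences for its distance converge. -/
def IsCompleteMetric (g : SmoothMetric m M) : Prop :=
  ∀ u : ℕ → M,
    (∀ ε : ENNReal, 0 < ε → ∃ N, ∀ j ≥ N, ∀ k ≥ N, metricDist g (u j) (u k) < ε) →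
    ∃ x, Filter.Tendsto u Filter.atTop (𝓝 x)

/-- `(M, g)` is isometric to the flat Euclidean space: some diffeomorphism `Ψ : M → ℝᵐ` pulls the
Euclidean metric back to `g`. -/
def IsometricToEuclidean (g : SmoothMetric m M) : Prop :=
  ∃ Ψ : M ≃ₘ⟮𝓡 m, 𝓡 m⟯ Euc m, ∀ (x : M) (u v : TangentSpace (𝓡 m) x),
    g.inner x u v =
      inner ℝ (show Euc m from mfderiv (𝓡 m) (𝓡 m) Ψ x u)
        (show Euc m from mfderiv (𝓡 m) (𝓡 m) Ψ x v)

end Riemannian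

section Rotations

/-- `ρ` is a rotation of `ℝᵏ`, an element of `SO(k)`. -/
def IsRotation {k : ℕ} (ρ : Euc k ≃ₗᵢ[ℝ] Euc k) : Prop :=
  LinearMap.det (ρ.toLinearEquiv : Euc k →ₗ[ℝ] Euc k) = 1

/-- The action of a linear isometry of `ℝᵏ⁺¹` on the unit sphere `Sᵏ`. -/
def sphereMap {k : ℕ} (ρ : Euc (k + 1) ≃ₗᵢ[ℝ] Euc (k + 1)) (x : Sph k) : Sph k :=
  ⟨ρ x, by simp⟩

variable (n : ℕ) (M : Type*) [TopologicalSpace M] [ChartedSpace (Euc (n + 1)) M]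

/-- An identification of `M` with one of the three standard rotationally symmetric manifolds
`Sⁿ⁺¹`, `ℝⁿ⁺¹`, `ℝ × Sⁿ`. -/
inductive StandardModel : Type _
  | sphere (Φ : M ≃ₘ⟮𝓡 (n + 1), 𝓡 (n + 1)⟯ Sph (n + 1)) : StandardModel
  | euclidean (Φ : M ≃ₘ⟮𝓡 (n + 1), 𝓡 (n + 1)⟯ Euc (n + 1)) : StandardModel
  | cylinder (Φ : M ≃ₘ⟮𝓡 (n + 1), 𝓘(ℝ, ℝ).prod (𝓡 n)⟯ (ℝ × Sph n)) : StandardModel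

variable {n M}

/-- The transformations of `M` by which the rotation group `SO(n+1)` acts under the identification:
the rotations of `Sⁿ⁺¹ ⊆ ℝⁿ⁺²` about the last coordinate axis, the rotations of `ℝⁿ⁺¹` about the
origin, and the rotations of the factor `Sⁿ` of `ℝ × Sⁿ`. -/
def StandardModel.rotations : StandardModel n M → Set (M → M)
  | .sphere Φ => {τ | ∃ ρ : Euc (n + 2) ≃ₗᵢ[ℝ] Euc (n + 2), IsRotation ρ ∧
      ρ (EuclideanSpace.single (Fin.last (n + 1)) 1) =
        EuclideanSpace.single (Fin.last (n + 1)) 1 ∧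
      ∀ x, τ x = Φ.symm (sphereMap ρ (Φ x))}
  | .euclidean Φ => {τ | ∃ ρ : Euc (n + 1) ≃ₗᵢ[ℝ] Euc (n + 1), IsRotation ρ ∧
      ∀ x, τ x = Φ.symm (ρ (Φ x))}
  | .cylinder Φ => {τ | ∃ ρ : Euc (n + 1) ≃ₗᵢ[ℝ] Euc (n + 1), IsRotation ρ ∧
      ∀ x, τ x = Φ.symm ((Φ x).1, sphereMap ρ (Φ x).2)}

/-- A function on `M` is rotationally symmetric if it is invariant under all rotations. -/
def StandardModel.SymmetricFunction (S : StandardModel n M) (f : M → ℝ) : Prop :=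
  ∀ τ ∈ S.rotations, ∀ x, f (τ x) = f x

/-- A metric on `M` is rotationally symmetric if all rotations are isometries of it. -/
def StandardModel.SymmetricMetric [IsManifold (𝓡 (n + 1)) ∞ M] (S : StandardModel n M)
    (g : SmoothMetric (n + 1) M) : Prop :=
  ∀ τ ∈ S.rotations, ∀ (x : M) (u v : TangentSpace (𝓡 (n + 1)) x),
    g.inner (τ x) (mfderiv (𝓡 (n + 1)) (𝓡 (n + 1)) τ x u)
      (mfderiv (𝓡 (n + 1)) (𝓡 (n + 1)) τ x v) = g.inner x u v

end Rotations

end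

/-!
The soliton equation determines the Hessian of the potential `f` from the metric alone. Hence, if
`ρ` is an isometry of `g`, then `f ∘ ρ - f` has vanishing Hessian, that is, its gradient is parallel
(`IsShrinkingSoliton.isParallel_sub`). Since the gradients of functions with vanishing Hessian have
constant inner products (`IsParallel.gradInner_eq`), such a function is determined by its value and
its differential at one point, and it is constant if it has a critical point.

On the sphere, `f ∘ ρ - f` has a maximum, so it is a constant, which is zero because `f` attains its
maximum and its minimum (`StandardModel.symmetricFunction_sphere`).

The manifolds `ℝⁿ⁺¹` and `ℝ × Sⁿ` both have a global chart in which the rotations act linearly, with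
target `ℝⁿ⁺¹` or `ℝⁿ⁺¹ \ {0}` (`IsRotationalChart`). As `n + 1 ≥ 3`, the metric is invariant under
all of `O(n + 1)`. If `f` is not symmetric, then some hyperplane reflection changes it, and the
difference is a nonzero function `H` with vanishing Hessian, odd under the reflection in the
hyperplane orthogonal to a unit vector `u` (`IsRotationalChart.exists_isOddParallel`). Comparing
parallel functions at points fixed by suitable reflections gives `H (r e) = ⟪e, u⟫ H (r u)` for all
unit vectors `e` (`IsOddParallel.apply_smul`). Therefore the gradient of `H` is radial on the axis
`ℝ u`, and, its length being constant, a multiple `c H` is an arc length parameter on the axis.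

In the case of the cylinder, `H` has no zero on the open half-axis, so the arc length is bounded
at one of its two ends, against completeness (`IsRotationalChart.false_of_isOddParallel`). In the
case of `ℝⁿ⁺¹`, the images of `c H` under reflections interchanging `u` with the coordinate vectors
have gradients that are orthonormal at the origin, hence everywhere. They are the components of a
local isometry to Euclidean space which maps each ray from the origin to itself; by completeness it
is bijective (`IsRotationalChart.exists_isometry`).
-/

noncomputable section

/-! ### The metric in a chart -/

section ChartDeriv

variable {m : ℕ} {M : Type*} [TopologicalSpace M] [ChartedSpace (Euc m) M]
  {φ : OpenPartialHomeomorph M (Euc m)}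

lemma mem_maximalAtlas_one (hφ : φ ∈ IsManifold.maximalAtlas (𝓡 m) ∞ M) :
    φ ∈ IsManifold.maximalAtlas (𝓡 m) 1 M :=
  IsManifold.maximalAtlas_subset_of_le (by simp) hφ

lemma mfderiv_comp_mfderiv_symm (hφ : φ ∈ IsManifold.maximalAtlas (𝓡 m) ∞ M) {y : Euc m}
    (hy : y ∈ φ.target) (v : Euc m) :
    mfderiv (𝓡 m) (𝓡 m) φ (φ.symm y) (mfderiv (𝓡 m) (𝓡 m) φ.symm y v) = v := by
  have h1 := mdifferentiableAt_symm_of_mem_maximalAtlas (mem_maximalAtlas_one hφ) hy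
  have h2 := mdifferentiableAt_of_mem_maximalAtlas (mem_maximalAtlas_one hφ) (φ.map_target hy)
  have h3 := mfderiv_comp y h2 h1
  have h4 : mfderiv (𝓡 m) (𝓡 m) (φ ∘ φ.symm) y = ContinuousLinearMap.id ℝ _ := by
    rw [← mfderiv_id (I := 𝓡 m) (x := y)]
    apply Filter.EventuallyEq.mfderiv_eq
    filter_upwards [φ.open_target.mem_nhds hy] with z hz using φ.right_inv hz
  rw [h4] at h3
  exact (DFunLike.congr_fun h3 v).symm

lemma mfderiv_symm_comp_mfderiv (hφ : φ ∈ IsManifold.maximalAtlas (𝓡 m) ∞ M) {x : M}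
    (hx : x ∈ φ.source) (v : TangentSpace (𝓡 m) x) :
    mfderiv (𝓡 m) (𝓡 m) φ.symm (φ x) (mfderiv (𝓡 m) (𝓡 m) φ x v) = v := by
  have h2 := mdifferentiableAt_symm_of_mem_maximalAtlas (mem_maximalAtlas_one hφ) (φ.map_source hx)
  have h1 := mdifferentiableAt_of_mem_maximalAtlas (mem_maximalAtlas_one hφ) hx
  have h3 := mfderiv_comp x h2 h1
  have h4 : mfderiv (𝓡 m) (𝓡 m) (φ.symm ∘ φ) x = ContinuousLinearMap.id ℝ _ := by
    rw [← mfderiv_id (I := 𝓡 m) (x := x)]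
    apply Filter.EventuallyEq.mfderiv_eq
    filter_upwards [φ.open_source.mem_nhds hx] with z hz using φ.left_inv hz
  rw [h4] at h3
  exact (DFunLike.congr_fun h3 v).symm

end ChartDeriv

section ChartMetric

variable {m : ℕ} {M : Type*} [TopologicalSpace M] [ChartedSpace (Euc m) M]
  [IsManifold (𝓡 m) ∞ M]

/-- The metric `g` in the chart `φ`, as a bilinear form on `ℝᵐ` depending on the point `y` of the
target of `φ`; `metricCoeff g φ y` is its matrix in the standard basis. -/
def chartMetric (g : SmoothMetric m M) (φ : OpenPartialHomeomorph M (Euc m)) (y : Euc m) :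
    LinearMap.BilinForm ℝ (Euc m) :=
  let D : Euc m →ₗ[ℝ] TangentSpace (𝓡 m) (φ.symm y) := (mfderiv (𝓡 m) (𝓡 m) φ.symm y).toLinearMap
  let B : TangentSpace (𝓡 m) (φ.symm y) →ₗ[ℝ] TangentSpace (𝓡 m) (φ.symm y) →ₗ[ℝ] ℝ :=
    LinearMap.mk₂ ℝ (fun a b => g.inner (φ.symm y) a b) (by simp) (by simp) (by simp) (by simp)
  B.compl₁₂ D D

lemma chartMetric_apply (g : SmoothMetric m M) (φ : OpenPartialHomeomorph M (Euc m))
    (y v w : Euc m) : chartMetric g φ y v w =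
      g.inner (φ.symm y) (mfderiv (𝓡 m) (𝓡 m) φ.symm y v) (mfderiv (𝓡 m) (𝓡 m) φ.symm y w) := rfl

lemma metricCoeff_eq (g : SmoothMetric m M) (φ : OpenPartialHomeomorph M (Euc m)) (y : Euc m)
    (i j : Fin m) : metricCoeff g φ y i j =
      chartMetric g φ y (EuclideanSpace.single i 1) (EuclideanSpace.single j 1) := rfl

variable (g : SmoothMetric m M) {φ ψ : OpenPartialHomeomorph M (Euc m)}

lemma chartMetric_comm (y v w : Euc m) : chartMetric g φ y v w = chartMetric g φ y w v :=
  g.symm _ _ _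

lemma chartMetric_eq_sum (y v w : Euc m) :
    chartMetric g φ y v w = ∑ i, ∑ j, v i * metricCoeff g φ y i j * w j := by
  have hv : v = ∑ i, v i • (EuclideanSpace.single i (1 : ℝ) : Euc m) := by
    simpa using ((EuclideanSpace.basisFun (Fin m) ℝ).sum_repr v).symm
  have hw : w = ∑ i, w i • (EuclideanSpace.single i (1 : ℝ) : Euc m) := by
    simpa using ((EuclideanSpace.basisFun (Fin m) ℝ).sum_repr w).symm
  conv_lhs => rw [hv, hw]
  simp only [map_sum, LinearMap.sum_apply, map_smul, LinearMap.smul_apply, smul_eq_mul]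
  simp only [Finset.mul_sum]
  rw [Finset.sum_comm]
  refine Finset.sum_congr rfl fun i _ => Finset.sum_congr rfl fun j _ => ?_
  rw [metricCoeff_eq]
  ring

lemma chartMetric_pos (hφ : φ ∈ IsManifold.maximalAtlas (𝓡 m) ∞ M) {y : Euc m}
    (hy : y ∈ φ.target) {v : Euc m} (hv : v ≠ 0) : 0 < chartMetric g φ y v v := by
  refine g.pos _ _ fun h => hv ?_
  exact (mfderiv_comp_mfderiv_symm hφ hy v).symm.trans
    ((congrArg (mfderiv (𝓡 m) (𝓡 m) φ (φ.symm y)) h).trans (map_zero _))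

lemma inner_eq_chartMetric (hφ : φ ∈ IsManifold.maximalAtlas (𝓡 m) ∞ M) {x : M}
    (hx : x ∈ φ.source) (v w : TangentSpace (𝓡 m) x) :
    g.inner x v w = chartMetric g φ (φ x) (mfderiv (𝓡 m) (𝓡 m) φ x v)
      (mfderiv (𝓡 m) (𝓡 m) φ x w) := by
  have key : ∀ z, z = x → ∀ a b : Euc m, g.inner x a b = g.inner z a b := by
    rintro z rfl a b; rfl
  exact (key _ (φ.left_inv hx) v w).trans
    (congrArg₂ (fun a b : Euc m => g.inner (φ.symm (φ x)) a b)
      (mfderiv_symm_comp_mfderiv hφ hx v).symm (mfderiv_symm_comp_mfderiv hφ hx w).symm)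

/-- The coordinate vector fields are smooth sections of the tangent bundle, as images of constant
fields under the tangent map of `φ.symm`, so their inner products are smooth. -/
lemma contDiffOn_metricCoeff (hφ : φ ∈ IsManifold.maximalAtlas (𝓡 m) ∞ M) (i j : Fin m) :
    ContDiffOn ℝ ∞ (fun y => metricCoeff g φ y i j) φ.target := by
  let : Bundle.RiemannianBundle (fun x : M => TangentSpace (𝓡 m) x) := ⟨g.toRiemannianMetric⟩
  have key : ∀ v : Euc m, ContMDiffOn (𝓡 m) ((𝓡 m).prod (𝓡 m)) ∞
      (fun y => (⟨φ.symm y, mfderiv (𝓡 m) (𝓡 m) φ.symm y v⟩ : TangentBundle (𝓡 m) M))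
      φ.target := by
    intro v y hy
    have h1 := (contMDiffOn_symm_of_mem_maximalAtlas hφ).contMDiffOn_tangentMapWithin
      (m := ∞) (by simp) φ.open_target.uniqueMDiffOn
    have h2 : ContMDiff (𝓡 m) ((𝓡 m).prod (𝓡 m)) ∞
        (fun y : Euc m => (⟨y, v⟩ : TangentBundle (𝓡 m) (Euc m))) := by
      intro z
      refine (Bundle.contMDiffAt_section (IB := 𝓡 m) (F := Euc m) (B := Euc m)
        (E := TangentSpace (𝓡 m)) (s := fun _ => v) z).2 ?_
      have hv : (fun x => (trivializationAt (Euc m) (TangentSpace (𝓡 m) (M := Euc m)) z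
          ⟨x, v⟩).2) = fun _ => v := by
        funext x
        rw [TangentBundle.trivializationAt_apply]
        change fderivWithin ℝ (id ∘ id) (Set.range id) _ v = v
        simp
      rw [hv]
      exact contMDiffAt_const
    have h3 := (h1 ⟨y, v⟩ hy).comp y (h2 y).contMDiffWithinAt (s := φ.target) (fun z hz => hz)
    refine h3.congr_of_mem (fun z hz => ?_) hy
    simp only [Function.comp, tangentMapWithin]
    rw [mfderivWithin_of_isOpen φ.open_target hz]
  have h := ContMDiffOn.inner_bundle (n := ∞) (key (EuclideanSpace.single i 1))
    (key (EuclideanSpace.single j 1))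
  exact h.contDiffOn

lemma differentiableAt_metricCoeff (hφ : φ ∈ IsManifold.maximalAtlas (𝓡 m) ∞ M) {y : Euc m}
    (hy : y ∈ φ.target) (i j : Fin m) :
    DifferentiableAt ℝ (fun y => metricCoeff g φ y i j) y :=
  ((contDiffOn_metricCoeff g hφ i j).contDiffAt (φ.open_target.mem_nhds hy)).differentiableAt
    (by simp)

lemma metricCoeff_comm (y : Euc m) (i j : Fin m) :
    metricCoeff g φ y i j = metricCoeff g φ y j i :=
  chartMetric_comm g _ _ _

lemma det_metricCoeff_ne_zero (hφ : φ ∈ IsManifold.maximalAtlas (𝓡 m) ∞ M) {y : Euc m}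
    (hy : y ∈ φ.target) : (metricCoeff g φ y).det ≠ 0 := by
  intro h
  obtain ⟨v, hv, hv'⟩ := Matrix.exists_mulVec_eq_zero_iff.2 h
  have := chartMetric_pos g hφ hy (v := WithLp.toLp 2 v) (by simpa using hv)
  rw [chartMetric_eq_sum] at this
  refine this.ne' (Finset.sum_eq_zero fun i _ => ?_)
  have hi : ∑ j, metricCoeff g φ y i j * v j = 0 := congrFun hv' i
  simp only [mul_assoc, ← Finset.mul_sum, hi, mul_zero]

/-- A local isometry `τ` relating two charts transports the metric of one to that of the other. -/
lemma chartMetric_eq_of_isometry (hφ : φ ∈ IsManifold.maximalAtlas (𝓡 m) ∞ M)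
    {τ : M → M} (hτ : MDifferentiable (𝓡 m) (𝓡 m) τ)
    (hτg : ∀ (x : M) (u v : TangentSpace (𝓡 m) x), g.inner (τ x) (mfderiv (𝓡 m) (𝓡 m) τ x u)
      (mfderiv (𝓡 m) (𝓡 m) τ x v) = g.inner x u v)
    (hψ : ∀ y ∈ φ.target, ψ.symm y = τ (φ.symm y)) {y : Euc m} (hy : y ∈ φ.target)
    (v w : Euc m) : chartMetric g ψ y v w = chartMetric g φ y v w := by
  have h1 : ψ.symm =ᶠ[𝓝 y] τ ∘ φ.symm := by
    filter_upwards [φ.open_target.mem_nhds hy] with z hz using hψ z hz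
  have h2 := mfderiv_comp y (hτ (φ.symm y))
    (mdifferentiableAt_symm_of_mem_maximalAtlas (mem_maximalAtlas_one hφ) hy)
  have key : ∀ v : Euc m, mfderiv (𝓡 m) (𝓡 m) ψ.symm y v =
      mfderiv (𝓡 m) (𝓡 m) τ (φ.symm y) (mfderiv (𝓡 m) (𝓡 m) φ.symm y v) := by
    intro v
    rw [h1.mfderiv_eq, h2]; rfl
  rw [chartMetric_apply, chartMetric_apply, key, key, ← hτg]
  have key' : ∀ x z : M, x = z → ∀ a b : Euc m, g.inner x a b = g.inner z a b := by
    rintro x z rfl a b; rfl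
  exact key' _ _ (hψ y hy) _ _

end ChartMetric

/-! ### Functions with vanishing Hessian -/

section Parallel

variable {m : ℕ} {M : Type*} [TopologicalSpace M] [ChartedSpace (Euc m) M]
  [IsManifold (𝓡 m) ∞ M]

/-- In the coordinates of the chart `φ`, the smooth function `K` has vanishing Hessian:
its gradient is a parallel vector field. -/
structure IsParallel (g : SmoothMetric m M) (φ : OpenPartialHomeomorph M (Euc m))
    (K : Euc m → ℝ) : Prop where
  contDiffOn : ContDiffOn ℝ ∞ K φ.target
  hessian_eq : ∀ y ∈ φ.target, ∀ i j,
    partialD i (partialD j K) y = ∑ k, christoffel g φ k i j y * partialD k K y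

/-- The components of the gradient of `K` in the chart `φ`. -/
def chartGradient (g : SmoothMetric m M) (φ : OpenPartialHomeomorph M (Euc m)) (K : Euc m → ℝ)
    (y : Euc m) : Fin m → ℝ :=
  (metricCoeff g φ y)⁻¹.mulVec fun j => partialD j K y

/-- The inner product `g(∇K, ∇L)` in the chart `φ`. -/
def gradInner (g : SmoothMetric m M) (φ : OpenPartialHomeomorph M (Euc m)) (K L : Euc m → ℝ)
    (y : Euc m) : ℝ :=
  ∑ i, chartGradient g φ K y i * partialD i L y

lemma fderiv_apply_eq_sum (K : Euc m → ℝ) (y w : Euc m) :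
    fderiv ℝ K y w = ∑ i, w i * partialD i K y := by
  have hw : w = ∑ i, w i • (EuclideanSpace.single i (1 : ℝ) : Euc m) := by
    simpa using ((EuclideanSpace.basisFun (Fin m) ℝ).sum_repr w).symm
  conv_lhs => rw [hw]
  simp [partialD]

section Calculus

variable {U : Set (Euc m)} {K L : Euc m → ℝ} {y : Euc m}

lemma partialD_congr (hU : IsOpen U) (h : Set.EqOn K L U) (hy : y ∈ U) (i : Fin m) :
    partialD i K y = partialD i L y := by
  have : K =ᶠ[𝓝 y] L := by filter_upwards [hU.mem_nhds hy] with z hz using h hz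
  simp only [partialD, this.fderiv_eq]

lemma ContDiffOn.partialD (h : ContDiffOn ℝ ∞ K U) (hU : IsOpen U) (i : Fin m) :
    ContDiffOn ℝ ∞ (partialD i K) U := by
  have := h.fderiv_of_isOpen hU (m := ∞) (by simp)
  exact this.clm_apply contDiffOn_const

lemma ContDiffOn.differentiableAt_of_isOpen (h : ContDiffOn ℝ ∞ K U) (hU : IsOpen U) (hy : y ∈ U) :
    DifferentiableAt ℝ K y :=
  (h.contDiffAt (hU.mem_nhds hy)).differentiableAt (by simp)

end Calculus

lemma partialD_sub {K L : Euc m → ℝ} {y : Euc m} (hK : DifferentiableAt ℝ K y)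
    (hL : DifferentiableAt ℝ L y) (i : Fin m) :
    partialD i (fun z => K z - L z) y = partialD i K y - partialD i L y := by
  simp [partialD, fderiv_fun_sub hK hL]

lemma partialD_const_mul {K : Euc m → ℝ} {y : Euc m} (hK : DifferentiableAt ℝ K y) (c : ℝ)
    (i : Fin m) : partialD i (fun z => c * K z) y = c * partialD i K y := by
  simp [partialD, fderiv_const_mul hK]

lemma partialD_mul {K L : Euc m → ℝ} {y : Euc m} (hK : DifferentiableAt ℝ K y)
    (hL : DifferentiableAt ℝ L y) (i : Fin m) :
    partialD i (fun z => K z * L z) y = partialD i K y * L y + K y * partialD i L y := by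
  simp [partialD, fderiv_fun_mul hK hL]
  ring

lemma partialD_sum {ι : Type*} (s : Finset ι) {K : ι → Euc m → ℝ} {y : Euc m}
    (hK : ∀ a ∈ s, DifferentiableAt ℝ (K a) y) (i : Fin m) :
    partialD i (fun z => ∑ a ∈ s, K a z) y = ∑ a ∈ s, partialD i (K a) y := by
  simp [partialD, fderiv_fun_sum hK]

variable {g : SmoothMetric m M} {φ : OpenPartialHomeomorph M (Euc m)} {K L : Euc m → ℝ}

namespace IsParallel

lemma differentiableAt (hK : IsParallel g φ K) {y : Euc m} (hy : y ∈ φ.target) :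
    DifferentiableAt ℝ K y :=
  hK.contDiffOn.differentiableAt_of_isOpen φ.open_target hy

lemma differentiableAt_partialD (hK : IsParallel g φ K) {y : Euc m} (hy : y ∈ φ.target)
    (i : Fin m) : DifferentiableAt ℝ (partialD i K) y :=
  (hK.contDiffOn.partialD φ.open_target i).differentiableAt_of_isOpen φ.open_target hy

lemma congr (hK : IsParallel g φ K) (h : Set.EqOn L K φ.target) : IsParallel g φ L := by
  have h1 : ∀ i, Set.EqOn (partialD i L) (partialD i K) φ.target :=
    fun i y hy => partialD_congr φ.open_target h hy i
  refine ⟨hK.contDiffOn.congr h, fun y hy i j => ?_⟩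
  rw [partialD_congr φ.open_target (h1 j) hy, hK.hessian_eq y hy]
  exact Finset.sum_congr rfl fun k _ => by rw [h1 k hy]

lemma sub (hK : IsParallel g φ K) (hL : IsParallel g φ L) :
    IsParallel g φ (fun y => K y - L y) := by
  have h1 : ∀ i, Set.EqOn (partialD i fun y => K y - L y)
      (fun y => partialD i K y - partialD i L y) φ.target :=
    fun i y hy => partialD_sub (hK.differentiableAt hy) (hL.differentiableAt hy) i
  refine ⟨hK.contDiffOn.sub hL.contDiffOn, fun y hy i j => ?_⟩
  rw [partialD_congr φ.open_target (h1 j) hy, partialD_sub (hK.differentiableAt_partialD hy j)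
    (hL.differentiableAt_partialD hy j), hK.hessian_eq y hy, hL.hessian_eq y hy,
    ← Finset.sum_sub_distrib]
  exact Finset.sum_congr rfl fun k _ => by rw [h1 k hy]; ring

lemma const_mul (hK : IsParallel g φ K) (c : ℝ) : IsParallel g φ (fun y => c * K y) := by
  have h1 : ∀ i, Set.EqOn (partialD i fun y => c * K y) (fun y => c * partialD i K y) φ.target :=
    fun i y hy => partialD_const_mul (hK.differentiableAt hy) c i
  refine ⟨contDiffOn_const.mul hK.contDiffOn, fun y hy i j => ?_⟩
  rw [partialD_congr φ.open_target (h1 j) hy, partialD_const_mul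
    (hK.differentiableAt_partialD hy j), hK.hessian_eq y hy, Finset.mul_sum]
  exact Finset.sum_congr rfl fun k _ => by rw [h1 k hy]; ring

end IsParallel

/-! ### Inner products of gradients of functions with vanishing Hessian are constant -/

lemma differentiableAt_det {n : ℕ} {A : Euc m → Matrix (Fin n) (Fin n) ℝ} {y : Euc m}
    (hA : ∀ i j, DifferentiableAt ℝ (fun z => A z i j) y) :
    DifferentiableAt ℝ (fun z => (A z).det) y := by
  simp only [Matrix.det_apply]
  exact DifferentiableAt.fun_sum fun σ _ =>
    (HasFDerivAt.finsetProd fun i _ => (hA (σ i) i).hasFDerivAt).differentiableAt.const_smul _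

lemma differentiableAt_matrix_inv {n : ℕ} {A : Euc m → Matrix (Fin n) (Fin n) ℝ} {y : Euc m}
    (hA : ∀ i j, DifferentiableAt ℝ (fun z => A z i j) y) (hdet : (A y).det ≠ 0) (i j : Fin n) :
    DifferentiableAt ℝ (fun z => (A z)⁻¹ i j) y := by
  -- Cramer's rule.
  have h1 : (fun z => (A z)⁻¹ i j) =
      fun z => (A z).det⁻¹ * ((A z).updateRow j (Pi.single i 1)).det := by
    funext z
    rw [Matrix.inv_def, Matrix.smul_apply, Matrix.adjugate_apply, Ring.inverse_eq_inv', smul_eq_mul]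
  rw [h1]
  refine ((differentiableAt_det hA).inv hdet).mul (differentiableAt_det fun k l => ?_)
  by_cases hk : k = j
  · subst hk
    simp
  · simpa [Matrix.updateRow_ne hk] using hA k l

lemma metricCoeff_mulVec_chartGradient (hφ : φ ∈ IsManifold.maximalAtlas (𝓡 m) ∞ M) {y : Euc m}
    (hy : y ∈ φ.target) (i : Fin m) :
    ∑ j, metricCoeff g φ y i j * chartGradient g φ K y j = partialD i K y := by
  have h : IsUnit (metricCoeff g φ y).det := (det_metricCoeff_ne_zero g hφ hy).isUnit
  have : (metricCoeff g φ y).mulVec (chartGradient g φ K y) = fun j => partialD j K y := by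
    rw [chartGradient, Matrix.mulVec_mulVec, Matrix.mul_nonsing_inv _ h, Matrix.one_mulVec]
  exact congrFun this i

lemma chartGradient_eq_of_mulVec (hφ : φ ∈ IsManifold.maximalAtlas (𝓡 m) ∞ M) {y : Euc m}
    (hy : y ∈ φ.target) {X : Fin m → ℝ}
    (hX : ∀ i, ∑ j, metricCoeff g φ y i j * X j = partialD i K y) : chartGradient g φ K y = X := by
  have h : IsUnit (metricCoeff g φ y).det := (det_metricCoeff_ne_zero g hφ hy).isUnit
  have : (fun j => partialD j K y) = (metricCoeff g φ y).mulVec X := funext fun i => (hX i).symm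
  rw [chartGradient, this, Matrix.mulVec_mulVec, Matrix.nonsing_inv_mul _ h, Matrix.one_mulVec]

lemma IsParallel.differentiableAt_chartGradient (hφ : φ ∈ IsManifold.maximalAtlas (𝓡 m) ∞ M)
    (hK : IsParallel g φ K) {y : Euc m} (hy : y ∈ φ.target) (i : Fin m) :
    DifferentiableAt ℝ (fun z => chartGradient g φ K z i) y := by
  simp only [chartGradient, Matrix.mulVec, dotProduct]
  exact DifferentiableAt.fun_sum fun j _ =>
    (differentiableAt_matrix_inv (differentiableAt_metricCoeff g hφ hy)
      (det_metricCoeff_ne_zero g hφ hy) i j).mul (hK.differentiableAt_partialD hy j)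

/-- The Hessian of a function with parallel gradient, paired with a vector `Y`. Raising the index of
`dK` turns the Christoffel symbols into those of the first kind, which do not involve the inverse
of the metric. -/
lemma IsParallel.sum_hessian (hK : IsParallel g φ K) {y : Euc m}
    (hy : y ∈ φ.target) (Y : Fin m → ℝ) (l : Fin m) :
    ∑ i, Y i * partialD l (partialD i K) y =
      (1 / 2 : ℝ) * ∑ i, ∑ q, Y i * chartGradient g φ K y q *
        (partialD l (fun z => metricCoeff g φ z i q) y
          + partialD i (fun z => metricCoeff g φ z l q) y
          - partialD q (fun z => metricCoeff g φ z l i) y) := by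
  have hsymm : ∀ k q, (metricCoeff g φ y)⁻¹ k q = (metricCoeff g φ y)⁻¹ q k := by
    intro k q
    have : (metricCoeff g φ y).transpose = metricCoeff g φ y := by
      ext i j; exact metricCoeff_comm g y j i
    conv_lhs => rw [← this, ← Matrix.transpose_nonsing_inv]
    rfl
  rw [Finset.mul_sum]
  refine Finset.sum_congr rfl fun i _ => ?_
  rw [hK.hessian_eq y hy, Finset.mul_sum]
  simp only [christoffel, chartGradient, Matrix.mulVec, dotProduct, Finset.mul_sum, Finset.sum_mul]
  rw [Finset.sum_comm]
  refine Finset.sum_congr rfl fun q _ => Finset.sum_congr rfl fun k _ => ?_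
  rw [hsymm k q]
  ring

/-- With `X = ∇K` and `Y = ∇L`, the derivative of `g(X, Y)` is a sum of the two Hessians paired with
`Y` and `X` and of a derivative of the metric. Expressed through the metric, the terms cancel: this
is the compatibility of the Levi-Civita connection with the metric. -/
lemma IsParallel.partialD_gradInner (hφ : φ ∈ IsManifold.maximalAtlas (𝓡 m) ∞ M)
    (hK : IsParallel g φ K) (hL : IsParallel g φ L) {y : Euc m} (hy : y ∈ φ.target) (l : Fin m) :
    partialD l (gradInner g φ K L) y = 0 := by
  set X := chartGradient g φ K with hX
  set Y := chartGradient g φ L with hY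
  set G := metricCoeff g φ with hG
  have dX : ∀ i, DifferentiableAt ℝ (fun z => X z i) y := hK.differentiableAt_chartGradient hφ hy
  have dG : ∀ i j, DifferentiableAt ℝ (fun z => G z i j) y := differentiableAt_metricCoeff g hφ hy
  -- Differentiating `G X = dK`.
  have hGX : ∀ i, ∑ j, (partialD l (fun z => G z i j) y * X y j +
      G y i j * partialD l (fun z => X z j) y) = partialD l (partialD i K) y := by
    intro i
    have h1 : Set.EqOn (fun z => ∑ j, G z i j * X z j) (partialD i K) φ.target :=
      fun z hz => metricCoeff_mulVec_chartGradient hφ hz i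
    rw [← partialD_congr φ.open_target h1 hy, partialD_sum _ fun j _ => (dG i j).fun_mul (dX j)]
    exact Finset.sum_congr rfl fun j _ => (partialD_mul (dG i j) (dX j) l).symm
  have hdL : ∀ i, partialD i L y = ∑ j, G y i j * Y y j :=
    fun i => (metricCoeff_mulVec_chartGradient hφ hy i).symm
  -- The product rule.
  have h2 : partialD l (gradInner g φ K L) y =
      ∑ i, (partialD l (fun z => X z i) y * partialD i L y +
        X y i * partialD l (partialD i L) y) := by
    have : gradInner g φ K L = fun z => ∑ i, X z i * partialD i L z := rfl
    rw [this, partialD_sum _ fun i _ => (dX i).fun_mul (hL.differentiableAt_partialD hy i)]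
    exact Finset.sum_congr rfl fun i _ => partialD_mul (dX i) (hL.differentiableAt_partialD hy i) l
  -- The derivative of `X`, paired with `dL = G Y`, is replaced by the Hessian of `K`.
  have h3 : ∑ i, partialD l (fun z => X z i) y * partialD i L y =
      ∑ i, Y y i * partialD l (partialD i K) y -
        ∑ i, ∑ j, Y y i * X y j * partialD l (fun z => G z i j) y := by
    have : ∑ i, partialD l (fun z => X z i) y * partialD i L y =
        ∑ i, ∑ j, Y y i * (G y i j * partialD l (fun z => X z j) y) := by
      rw [Finset.sum_comm]
      refine Finset.sum_congr rfl fun i _ => ?_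
      rw [hdL, Finset.mul_sum]
      refine Finset.sum_congr rfl fun j _ => ?_
      rw [show G y i j = G y j i from metricCoeff_comm g y i j]
      ring
    rw [this, ← Finset.sum_sub_distrib]
    refine Finset.sum_congr rfl fun i _ => ?_
    rw [← hGX i, Finset.mul_sum, ← Finset.sum_sub_distrib]
    exact Finset.sum_congr rfl fun j _ => by ring
  rw [h2, Finset.sum_add_distrib, h3, hK.sum_hessian hy, hL.sum_hessian hy]
  have hswap : ∑ i, ∑ q, X y i * Y y q * (partialD l (fun z => G z i q) y
        + partialD i (fun z => G z l q) y - partialD q (fun z => G z l i) y) =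
      ∑ i, ∑ q, Y y i * X y q * (partialD l (fun z => G z i q) y
        + partialD q (fun z => G z l i) y - partialD i (fun z => G z l q) y) := by
    rw [Finset.sum_comm]
    refine Finset.sum_congr rfl fun i _ => Finset.sum_congr rfl fun j _ => ?_
    rw [show (fun z => G z i j) = fun z => G z j i from funext fun z => metricCoeff_comm g z i j]
    ring
  rw [← hX, ← hY, hswap]
  simp only [Finset.mul_sum, ← Finset.sum_sub_distrib, ← Finset.sum_add_distrib]
  exact Finset.sum_eq_zero fun i _ => Finset.sum_eq_zero fun j _ => by ring

/-- Functions with parallel gradients have gradients with constant inner product. -/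
lemma IsParallel.gradInner_eq (hφ : φ ∈ IsManifold.maximalAtlas (𝓡 m) ∞ M)
    (hconn : IsPreconnected φ.target) (hK : IsParallel g φ K) (hL : IsParallel g φ L)
    {y z : Euc m} (hy : y ∈ φ.target) (hz : z ∈ φ.target) :
    gradInner g φ K L y = gradInner g φ K L z := by
  refine φ.open_target.is_const_of_fderiv_eq_zero (𝕜 := ℝ) hconn ?_ ?_ hy hz
  · intro x hx
    refine DifferentiableAt.differentiableWithinAt ?_
    exact DifferentiableAt.fun_sum fun i _ =>
      (hK.differentiableAt_chartGradient hφ hx i).mul (hL.differentiableAt_partialD hx i)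
  · intro x hx
    ext w
    rw [fderiv_apply_eq_sum]
    exact Finset.sum_eq_zero fun i _ => by rw [hK.partialD_gradInner hφ hL hx]; simp

lemma gradInner_self_eq (hφ : φ ∈ IsManifold.maximalAtlas (𝓡 m) ∞ M) {y : Euc m}
    (hy : y ∈ φ.target) : gradInner g φ K K y =
      chartMetric g φ y (WithLp.toLp 2 (chartGradient g φ K y))
        (WithLp.toLp 2 (chartGradient g φ K y)) := by
  rw [chartMetric_eq_sum, gradInner]
  refine Finset.sum_congr rfl fun i _ => ?_
  rw [← metricCoeff_mulVec_chartGradient hφ hy, Finset.mul_sum]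
  exact Finset.sum_congr rfl fun j _ => by simp; ring

lemma fderiv_eq_zero_of_gradInner_self (hφ : φ ∈ IsManifold.maximalAtlas (𝓡 m) ∞ M) {y : Euc m}
    (hy : y ∈ φ.target) (h : gradInner g φ K K y = 0) : fderiv ℝ K y = 0 := by
  have hX : chartGradient g φ K y = 0 := by
    by_contra hne
    rw [gradInner_self_eq hφ hy] at h
    exact (chartMetric_pos g hφ hy (by simpa using hne)).ne' h
  ext w
  rw [fderiv_apply_eq_sum]
  refine Finset.sum_eq_zero fun i _ => ?_
  rw [← metricCoeff_mulVec_chartGradient (g := g) hφ hy, hX]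
  simp

lemma gradInner_self_of_fderiv_eq_zero {y : Euc m} (h : fderiv ℝ K y = 0) :
    gradInner g φ K K y = 0 := by
  simp [gradInner, partialD, h]

/-- A function with parallel gradient and a critical point is constant. -/
lemma IsParallel.eq_of_fderiv_eq_zero (hφ : φ ∈ IsManifold.maximalAtlas (𝓡 m) ∞ M)
    (hconn : IsPreconnected φ.target) (hK : IsParallel g φ K) {y₀ y z : Euc m}
    (hy₀ : y₀ ∈ φ.target) (h₀ : fderiv ℝ K y₀ = 0) (hy : y ∈ φ.target) (hz : z ∈ φ.target) :
    K y = K z := by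
  refine φ.open_target.is_const_of_fderiv_eq_zero (𝕜 := ℝ) hconn
    (fun x hx => (hK.differentiableAt hx).differentiableWithinAt) (fun x hx => ?_) hy hz
  refine fderiv_eq_zero_of_gradInner_self hφ hx (g := g) ?_
  rw [hK.gradInner_eq hφ hconn hK hx hy₀, gradInner_self_of_fderiv_eq_zero h₀]

/-- A function with parallel gradient is determined by its value and differential at a point. -/
lemma IsParallel.eqOn (hφ : φ ∈ IsManifold.maximalAtlas (𝓡 m) ∞ M)
    (hconn : IsPreconnected φ.target) (hK : IsParallel g φ K) (hL : IsParallel g φ L) {y₀ : Euc m}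
    (hy₀ : y₀ ∈ φ.target) (h₀ : K y₀ = L y₀) (h₁ : ∀ w, fderiv ℝ K y₀ w = fderiv ℝ L y₀ w) :
    Set.EqOn K L φ.target := by
  intro y hy
  have h2 : fderiv ℝ (fun z => K z - L z) y₀ = 0 := by
    rw [fderiv_fun_sub (hK.differentiableAt hy₀) (hL.differentiableAt hy₀), sub_eq_zero]
    ext w; exact h₁ w
  have := (hK.sub hL).eq_of_fderiv_eq_zero hφ hconn hy₀ h2 hy hy₀
  simp only [h₀, sub_self] at this
  linarith

/-- For a soliton `(g, f, lam)`, two charts in which `g` has the same coefficients give the same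
Ricci tensor, so the Hessians of the two coordinate expressions of `f` agree. -/
lemma IsShrinkingSoliton.isParallel_sub {f : M → ℝ} {lam : ℝ} (hsol : IsShrinkingSoliton g f lam)
    {ψ : OpenPartialHomeomorph M (Euc m)} (hφ : φ ∈ IsManifold.maximalAtlas (𝓡 m) ∞ M)
    (hψ : ψ ∈ IsManifold.maximalAtlas (𝓡 m) ∞ M) (htarget : ψ.target = φ.target)
    (hcoeff : ∀ y ∈ φ.target, ∀ i j, metricCoeff g ψ y i j = metricCoeff g φ y i j) :
    IsParallel g φ (fun y => f (ψ.symm y) - f (φ.symm y)) := by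
  have hG : ∀ y ∈ φ.target, metricCoeff g ψ y = metricCoeff g φ y :=
    fun y hy => Matrix.ext (hcoeff y hy)
  have hΓ : ∀ k i j, Set.EqOn (christoffel g ψ k i j) (christoffel g φ k i j) φ.target := by
    intro k i j y hy
    have hd : ∀ a i j, partialD a (fun z => metricCoeff g ψ z i j) y =
        partialD a (fun z => metricCoeff g φ z i j) y :=
      fun a i j => partialD_congr φ.open_target (fun z hz => hcoeff z hz i j) hy a
    simp only [christoffel, hG y hy, hd]
  have hRic : ∀ y ∈ φ.target, ∀ i j, ricci g ψ i j y = ricci g φ i j y := by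
    intro y hy i j
    have hd : ∀ a k i j, partialD a (christoffel g ψ k i j) y =
        partialD a (christoffel g φ k i j) y :=
      fun a k i j => partialD_congr φ.open_target (hΓ k i j) hy a
    simp only [ricci, hd, hΓ _ _ _ hy]
  have hsm : ∀ χ ∈ IsManifold.maximalAtlas (𝓡 m) ∞ M, ContDiffOn ℝ ∞ (f ∘ χ.symm) χ.target :=
    fun χ hχ => (hsol.smooth.comp_contMDiffOn (contMDiffOn_symm_of_mem_maximalAtlas hχ)).contDiffOn
  have hP := hsm φ hφ
  have hQ := hsm ψ hψ
  rw [htarget] at hQ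
  have hop := φ.open_target
  have h1 : ∀ i, Set.EqOn (partialD i fun y => f (ψ.symm y) - f (φ.symm y))
      (fun y => partialD i (f ∘ ψ.symm) y - partialD i (f ∘ φ.symm) y) φ.target :=
    fun i y hy => partialD_sub (hQ.differentiableAt_of_isOpen hop hy)
      (hP.differentiableAt_of_isOpen hop hy) i
  refine ⟨hQ.sub hP, fun y hy i j => ?_⟩
  have e1 := hsol.equation φ hφ y hy i j
  have e2 := hsol.equation ψ hψ y (htarget ▸ hy) i j
  rw [hRic y hy, hcoeff y hy] at e2
  simp only [hessian, hΓ _ _ _ hy] at e1 e2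
  rw [partialD_congr hop (h1 j) hy, partialD_sub
    ((hQ.partialD hop j).differentiableAt_of_isOpen hop hy)
    ((hP.partialD hop j).differentiableAt_of_isOpen hop hy)]
  have e3 : ∑ k, christoffel g φ k i j y * partialD k (fun y => f (ψ.symm y) - f (φ.symm y)) y =
      ∑ k, christoffel g φ k i j y * partialD k (f ∘ ψ.symm) y -
      ∑ k, christoffel g φ k i j y * partialD k (f ∘ φ.symm) y := by
    rw [← Finset.sum_sub_distrib]
    exact Finset.sum_congr rfl fun k _ => by rw [h1 k hy]; ring
  rw [e3]
  linarith

end Parallel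

/-! ### Hyperplane reflections -/

section Reflections

variable {m : ℕ}

/-- The reflection of `ℝᵐ` in the hyperplane orthogonal to `z` (the identity if `z = 0`). -/
def hyperRefl (z : Euc m) : Euc m ≃ₗᵢ[ℝ] Euc m := (Submodule.span ℝ {z})ᗮ.reflection

lemma hyperRefl_of_inner_eq_zero {z x : Euc m} (h : inner ℝ z x = 0) : hyperRefl z x = x :=
  Submodule.reflection_mem_subspace_eq_self (Submodule.mem_orthogonal_singleton_iff_inner_right.2 h)

lemma hyperRefl_self (z : Euc m) : hyperRefl z z = -z :=
  Submodule.reflection_orthogonalComplement_singleton_eq_neg z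

lemma hyperRefl_hyperRefl (z x : Euc m) : hyperRefl z (hyperRefl z x) = x :=
  Submodule.reflection_reflection _ x

lemma inner_hyperRefl_left (z x y : Euc m) :
    inner ℝ (hyperRefl z x) y = inner ℝ x (hyperRefl z y) := by
  rw [← (hyperRefl z).inner_map_map x, hyperRefl_hyperRefl]

lemma hyperRefl_sub_left {a b : Euc m} (h : ‖a‖ = ‖b‖) : hyperRefl (a - b) a = b :=
  Submodule.reflection_sub h

lemma hyperRefl_sub_right {a b : Euc m} (h : ‖a‖ = ‖b‖) : hyperRefl (a - b) b = a := by
  nth_rw 2 [← hyperRefl_sub_left h]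
  exact hyperRefl_hyperRefl _ _

lemma det_hyperRefl {z : Euc m} (hz : z ≠ 0) :
    LinearMap.det ((hyperRefl z).toLinearEquiv : Euc m →ₗ[ℝ] Euc m) = -1 := by
  have h := Submodule.det_reflection (𝕜 := ℝ) (Submodule.span ℝ {z})ᗮ
  rw [Submodule.orthogonal_orthogonal, finrank_span_singleton hz, pow_one] at h
  exact h

lemma det_isometry (ρ : Euc m ≃ₗᵢ[ℝ] Euc m) :
    LinearMap.det (ρ.toLinearEquiv : Euc m →ₗ[ℝ] Euc m) = 1 ∨
      LinearMap.det (ρ.toLinearEquiv : Euc m →ₗ[ℝ] Euc m) = -1 := by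
  let b := EuclideanSpace.basisFun (Fin m) ℝ
  have h := (b.map ρ).det_to_matrix_orthonormalBasis_real b
  have h' := b.det_to_matrix_orthonormalBasis_real (b.map ρ)
  have e : b.toBasis.det (b.map ρ) = LinearMap.det (ρ.toLinearEquiv : Euc m →ₗ[ℝ] Euc m) := by
    have := Module.Basis.det_comp b.toBasis (ρ.toLinearEquiv : Euc m →ₗ[ℝ] Euc m) b
    have h1 : b.toBasis.det b = 1 := by
      rw [← OrthonormalBasis.coe_toBasis]; exact b.toBasis.det_self
    rw [h1, mul_one] at this
    rw [← this]
    congr 1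
  rwa [e] at h'

lemma exists_unit_orthogonal (hm : 3 ≤ m) (a b : Euc m) :
    ∃ z : Euc m, ‖z‖ = 1 ∧ inner ℝ a z = 0 ∧ inner ℝ b z = 0 := by
  have h := (Submodule.span ℝ {a, b}).finrank_add_finrank_orthogonal
  have h2 : Module.finrank ℝ (Submodule.span ℝ ({a, b} : Set (Euc m))) ≤ 2 := by
    have := finrank_span_finset_le_card (R := ℝ) ({a, b} : Finset (Euc m))
    rw [Finset.coe_pair] at this
    exact this.trans Finset.card_le_two
  rw [finrank_euclideanSpace_fin] at h
  have hne : (Submodule.span ℝ ({a, b} : Set (Euc m)))ᗮ ≠ ⊥ := by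
    intro h0
    rw [h0, finrank_bot] at h
    omega
  obtain ⟨z, hz, hz0⟩ := Submodule.exists_mem_ne_zero_of_ne_bot hne
  have hort : ∀ x ∈ ({a, b} : Set (Euc m)), inner ℝ x z = 0 :=
    fun x hx => Submodule.inner_right_of_mem_orthogonal (Submodule.subset_span hx) hz
  refine ⟨‖z‖⁻¹ • z, norm_smul_inv_norm hz0, ?_, ?_⟩ <;> rw [inner_smul_right, hort _ (by simp),
    mul_zero]

end Reflections

/-! ### Charts in which the rotations act linearly -/

section Radial

variable {m : ℕ} {M : Type*} [TopologicalSpace M] [ChartedSpace (Euc m) M]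
  [IsManifold (𝓡 m) ∞ M]

/-- A global chart of `M` onto `ℝᵐ` or `ℝᵐ \ {0}` in which the metric `g` is invariant under
the rotations of `ℝᵐ`. -/
structure IsRotationalChart (g : SmoothMetric m M) (φ : OpenPartialHomeomorph M (Euc m)) :
    Prop where
  mem_maximalAtlas : φ ∈ IsManifold.maximalAtlas (𝓡 m) ∞ M
  source_eq : φ.source = Set.univ
  mem_target : ∀ y ≠ 0, y ∈ φ.target
  rotation_invariant : ∀ ρ : Euc m ≃ₗᵢ[ℝ] Euc m, IsRotation ρ → ∀ y ∈ φ.target, ∀ v w,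
    chartMetric g φ (ρ y) (ρ v) (ρ w) = chartMetric g φ y v w

variable {g : SmoothMetric m M} {φ : OpenPartialHomeomorph M (Euc m)}

lemma chartMetric_transHomeomorph (hφ : φ ∈ IsManifold.maximalAtlas (𝓡 m) ∞ M)
    (ρ : Euc m ≃ₗᵢ[ℝ] Euc m) {y : Euc m} (hy : ρ y ∈ φ.target) (v w : Euc m) :
    chartMetric g (φ.transHomeomorph ρ.symm.toHomeomorph) y v w =
      chartMetric g φ (ρ y) (ρ v) (ρ w) := by
  have hρ : MDifferentiableAt (𝓡 m) (𝓡 m) ρ y := ρ.differentiable.differentiableAt.mdifferentiableAt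
  have key : ∀ v : Euc m, mfderiv (𝓡 m) (𝓡 m) (φ.symm ∘ ρ) y v =
      mfderiv (𝓡 m) (𝓡 m) φ.symm (ρ y) (ρ v) := by
    intro v
    have h1 := mfderiv_comp y (mdifferentiableAt_symm_of_mem_maximalAtlas
      (mem_maximalAtlas_one hφ) hy) hρ
    have h2 : mfderiv (𝓡 m) (𝓡 m) ρ y v = ρ v := by
      rw [mfderiv_eq_fderiv]
      exact congrArg (fun T : Euc m →L[ℝ] Euc m => T v) ρ.fderiv
    rw [h1]
    exact congrArg (mfderiv (𝓡 m) (𝓡 m) φ.symm (ρ y)) h2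
  rw [chartMetric_apply, chartMetric_apply]
  exact congrArg₂ (fun a b : Euc m => g.inner (φ.symm (ρ y)) a b) (key v) (key w)

namespace IsRotationalChart

lemma map_mem_target (hφ : IsRotationalChart g φ) (ρ : Euc m ≃ₗᵢ[ℝ] Euc m) {y : Euc m}
    (hy : y ∈ φ.target) : ρ y ∈ φ.target := by
  by_cases h : y = 0
  · subst h; simpa using hy
  · exact hφ.mem_target _ (by simpa using h)

lemma isPreconnected_target (hφ : IsRotationalChart g φ) (hm : 3 ≤ m) :
    IsPreconnected φ.target := by
  have hrank : 1 < Module.rank ℝ (Euc m) := by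
    rw [← Module.finrank_eq_rank, finrank_euclideanSpace_fin]
    exact_mod_cast (by omega : 1 < m)
  by_cases h : (0 : Euc m) ∈ φ.target
  · have : φ.target = Set.univ := Set.eq_univ_of_forall fun y => by
      by_cases hy : y = 0
      · exact hy ▸ h
      · exact hφ.mem_target y hy
    rw [this]
    exact isPreconnected_univ
  · have : φ.target = {0}ᶜ := by
      ext y
      exact ⟨fun hy h0 => h (by rw [← Set.mem_singleton_iff.1 h0]; exact hy), hφ.mem_target y⟩
    rw [this]
    exact (isConnected_compl_singleton_of_one_lt_rank hrank _).isPreconnected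

/-- In dimension at least three, a rotation-invariant metric is invariant under all linear
isometries: a given isometry and a given pair of vectors are not affected by composition with the
reflection in a hyperplane containing the pair, which makes the determinant `1`. -/
lemma isometry_invariant (hφ : IsRotationalChart g φ) (hm : 3 ≤ m) (ρ : Euc m ≃ₗᵢ[ℝ] Euc m)
    {y : Euc m} (hy : y ∈ φ.target) (v w : Euc m) :
    chartMetric g φ (ρ y) (ρ v) (ρ w) = chartMetric g φ y v w := by
  -- By polarization, it is enough to consider `v = w`.
  have hquad : ∀ x, chartMetric g φ (ρ y) (ρ x) (ρ x) = chartMetric g φ y x x := by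
    intro x
    rcases det_isometry ρ with h | h
    · exact hφ.rotation_invariant ρ h y hy x x
    · obtain ⟨z, hz, hzy, hzx⟩ := exists_unit_orthogonal hm y x
      have hz0 : z ≠ 0 := by rintro rfl; simp at hz
      rw [real_inner_comm] at hzy hzx
      have hdet : IsRotation ((hyperRefl z).trans ρ) := by
        have : (((hyperRefl z).trans ρ).toLinearEquiv : Euc m →ₗ[ℝ] Euc m) =
          (ρ.toLinearEquiv : Euc m →ₗ[ℝ] Euc m) ∘ₗ
            ((hyperRefl z).toLinearEquiv : Euc m →ₗ[ℝ] Euc m) := rfl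
        rw [IsRotation, this, LinearMap.det_comp, det_hyperRefl hz0, h]
        norm_num
      have := hφ.rotation_invariant _ hdet y hy x x
      simpa [hyperRefl_of_inner_eq_zero hzy, hyperRefl_of_inner_eq_zero hzx] using this
  have h1 := hquad (v + w)
  simp only [map_add, LinearMap.add_apply] at h1
  rw [hquad v, hquad w, chartMetric_comm g y w v, chartMetric_comm g (ρ y) (ρ w) (ρ v)] at h1
  linarith

/-- The chart `φ` followed by the inverse of a linear isometry `ρ` has the same metric coefficients
as `φ`, so the coordinate expressions of `f` in the two charts have the same Hessian. -/
lemma isParallel_comp_sub (hφ : IsRotationalChart g φ) (hm : 3 ≤ m) {f : M → ℝ} {lam : ℝ}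
    (hsol : IsShrinkingSoliton g f lam) (ρ : Euc m ≃ₗᵢ[ℝ] Euc m) :
    IsParallel g φ (fun y => f (φ.symm (ρ y)) - f (φ.symm y)) := by
  let ψ : OpenPartialHomeomorph M (Euc m) := φ.transHomeomorph ρ.symm.toHomeomorph
  have hψsymm : ∀ y, ψ.symm y = φ.symm (ρ y) := fun y => rfl
  have htarget : ψ.target = φ.target := by
    ext y
    change ρ y ∈ φ.target ↔ _
    exact ⟨fun h => by simpa using hφ.map_mem_target ρ.symm h, fun h => hφ.map_mem_target ρ h⟩
  have hψ : ψ ∈ IsManifold.maximalAtlas (𝓡 m) ∞ M := by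
    refine ψ.mem_maximalAtlas_of_contMDiffOn ?_ ?_
    · exact ρ.symm.contDiff.contMDiff.comp_contMDiffOn
        (contMDiffOn_of_mem_maximalAtlas hφ.mem_maximalAtlas)
    · rw [htarget]
      exact (contMDiffOn_symm_of_mem_maximalAtlas hφ.mem_maximalAtlas).comp
        ρ.contDiff.contMDiff.contMDiffOn fun y hy => hφ.map_mem_target ρ hy
  refine hsol.isParallel_sub hφ.mem_maximalAtlas hψ htarget fun y hy i j => ?_
  rw [metricCoeff_eq, metricCoeff_eq, ← hφ.isometry_invariant hm ρ hy]
  exact chartMetric_transHomeomorph hφ.mem_maximalAtlas ρ (hφ.map_mem_target ρ hy) _ _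

/-- The axis through a unit vector `u` is orthogonal to the orbits: if `v` is orthogonal to `u` in
the Euclidean sense, the reflection with normal `v` fixes the axis and reverses `v`. -/
lemma chartMetric_axis (hφ : IsRotationalChart g φ) (hm : 3 ≤ m)
    {u : Euc m} (hu : ‖u‖ = 1) {r : ℝ} (hr : r • u ∈ φ.target) (w : Euc m) :
    chartMetric g φ (r • u) w u = inner ℝ u w * chartMetric g φ (r • u) u u := by
  set v := w - (inner ℝ u w : ℝ) • u with hv
  have hvu : inner ℝ v u = 0 := by
    rw [hv, inner_sub_left, inner_smul_left, real_inner_self_eq_norm_sq, hu,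
      real_inner_comm u w]; simp
  have h1 := hφ.isometry_invariant hm (hyperRefl v) hr v u
  rw [map_smul, hyperRefl_of_inner_eq_zero hvu, hyperRefl_self, map_neg,
    LinearMap.neg_apply] at h1
  have h3 : chartMetric g φ (r • u) v u = 0 := by linarith
  rw [hv, map_sub, map_smul, LinearMap.sub_apply, LinearMap.smul_apply, smul_eq_mul] at h3
  linarith

end IsRotationalChart
end Radial

/-! ### A parallel gradient that breaks the symmetry -/

section OddParallel

variable {m : ℕ} {M : Type*} [TopologicalSpace M] [ChartedSpace (Euc m) M]
  [IsManifold (𝓡 m) ∞ M]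

/-- `H` and all its images under linear isometries have vanishing Hessian, and `H` is odd under
the reflection in the hyperplane orthogonal to the unit vector `u`, but not zero. -/
structure IsOddParallel (g : SmoothMetric m M) (φ : OpenPartialHomeomorph M (Euc m))
    (u : Euc m) (H : Euc m → ℝ) : Prop where
  norm_eq : ‖u‖ = 1
  isParallel_comp : ∀ ρ : Euc m ≃ₗᵢ[ℝ] Euc m, IsParallel g φ (fun y => H (ρ y))
  odd : ∀ y, H (hyperRefl u y) = -H y
  exists_ne_zero : ∃ y ∈ φ.target, H y ≠ 0

variable {g : SmoothMetric m M} {φ : OpenPartialHomeomorph M (Euc m)}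

/-- If the potential is not invariant under rotations, then it is changed by a reflection in a
hyperplane, and the difference has vanishing Hessian and is odd. -/
lemma IsRotationalChart.exists_isOddParallel (hφ : IsRotationalChart g φ) (hm : 3 ≤ m)
    {f : M → ℝ} {lam : ℝ} (hsol : IsShrinkingSoliton g f lam) {ρ : Euc m ≃ₗᵢ[ℝ] Euc m} {y : Euc m}
    (hy : y ∈ φ.target) (hρ : f (φ.symm (ρ y)) ≠ f (φ.symm y)) :
    ∃ u H, IsOddParallel g φ u H := by
  have hne : y - ρ y ≠ 0 := fun h => hρ (by rw [← sub_eq_zero.1 h])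
  have href : ∀ {c : ℝ} (_ : c ≠ 0) (z x : Euc m), hyperRefl (c • z) x = hyperRefl z x := by
    intro c hc z x
    simp only [hyperRefl, Submodule.span_singleton_smul_eq (IsUnit.mk0 c hc)]
  let u := ‖y - ρ y‖⁻¹ • (y - ρ y)
  have hu : ∀ x, hyperRefl u x = hyperRefl (y - ρ y) x :=
    href (inv_ne_zero (norm_ne_zero_iff.2 hne)) _
  refine ⟨u, fun x => f (φ.symm (hyperRefl u x)) - f (φ.symm x), norm_smul_inv_norm hne, ?_, ?_,
    y, hy, ?_⟩
  · intro σ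
    refine ((hφ.isParallel_comp_sub hm hsol (σ.trans (hyperRefl u))).sub
      (hφ.isParallel_comp_sub hm hsol σ)).congr fun x _ => ?_
    simp
  · intro x
    simp only [hyperRefl_hyperRefl]
    ring
  · simp only [hu, hyperRefl_sub_left (ρ.norm_map y).symm]
    exact sub_ne_zero.2 hρ

namespace IsOddParallel

variable {u : Euc m} {H : Euc m → ℝ}

lemma isParallel (hH : IsOddParallel g φ u H) : IsParallel g φ H :=
  hH.isParallel_comp (LinearIsometryEquiv.refl ℝ (Euc m))

lemma fderiv_comp (hH : IsOddParallel g φ u H) (hφ : IsRotationalChart g φ)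
    (ρ : Euc m ≃ₗᵢ[ℝ] Euc m) {y : Euc m} (hy : y ∈ φ.target) (w : Euc m) :
    fderiv ℝ (fun x => H (ρ x)) y w = fderiv ℝ H (ρ y) (ρ w) := by
  have h1 := hH.isParallel.differentiableAt (hφ.map_mem_target ρ hy)
  have h2 : HasFDerivAt (fun x => H (ρ x)) _ y := h1.hasFDerivAt.comp y
    (ρ.toContinuousLinearEquiv : Euc m →L[ℝ] Euc m).hasFDerivAt
  rw [h2.fderiv]
  rfl

lemma eq_zero_of_orthogonal (hH : IsOddParallel g φ u H) {y : Euc m} (h : inner ℝ u y = 0) :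
    H y = 0 := by
  have := hH.odd y
  rw [hyperRefl_of_inner_eq_zero h] at this
  linarith

lemma fderiv_eq_zero_of_orthogonal (hH : IsOddParallel g φ u H) (hφ : IsRotationalChart g φ)
    {y w : Euc m} (hy : y ∈ φ.target) (h : inner ℝ u y = 0) (hw : inner ℝ u w = 0) :
    fderiv ℝ H y w = 0 := by
  have h1 := hH.fderiv_comp hφ (hyperRefl u) hy w
  have h2 : (fun x => H (hyperRefl u x)) = fun x => -H x := funext hH.odd
  rw [h2, fderiv_fun_neg, hyperRefl_of_inner_eq_zero h, hyperRefl_of_inner_eq_zero hw] at h1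
  simp only [neg_apply] at h1
  linarith

lemma fderiv_eq_of_orthogonal (hH : IsOddParallel g φ u H) (hφ : IsRotationalChart g φ)
    {y : Euc m} (hy : y ∈ φ.target) (h : inner ℝ u y = 0) (w : Euc m) :
    fderiv ℝ H y w = fderiv ℝ H y u * inner ℝ u w := by
  have h1 : inner ℝ u (w - (inner ℝ u w : ℝ) • u) = 0 := by
    rw [inner_sub_right, inner_smul_right, real_inner_self_eq_norm_sq, hH.norm_eq]; ring
  have h2 := hH.fderiv_eq_zero_of_orthogonal hφ hy h h1
  rw [map_sub, map_smul, smul_eq_mul] at h2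
  linarith

/-- The points orthogonal to two given vectors are used as base points at which parallel functions
are compared; they avoid the origin, which need not belong to the chart. -/
lemma exists_mem_target_orthogonal (hφ : IsRotationalChart g φ) (hm : 3 ≤ m) (a b : Euc m) :
    ∃ y ∈ φ.target, inner ℝ a y = 0 ∧ inner ℝ b y = 0 := by
  obtain ⟨z, hz, hz1, hz2⟩ := exists_unit_orthogonal hm a b
  exact ⟨z, hφ.mem_target z (by rintro rfl; simp at hz), hz1, hz2⟩

lemma fderiv_ne_zero (hH : IsOddParallel g φ u H) (hφ : IsRotationalChart g φ) (hm : 3 ≤ m)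
    {y : Euc m} (hy : y ∈ φ.target) : fderiv ℝ H y ≠ 0 := by
  intro h
  obtain ⟨x, hx, hx0⟩ := hH.exists_ne_zero
  obtain ⟨z, hz, hz1, -⟩ := exists_mem_target_orthogonal hφ hm u u
  exact hx0 <| (hH.isParallel.eq_of_fderiv_eq_zero hφ.mem_maximalAtlas
    (hφ.isPreconnected_target hm) hy h hx hz).trans (hH.eq_zero_of_orthogonal hz1)

lemma fderiv_self_ne_zero (hH : IsOddParallel g φ u H) (hφ : IsRotationalChart g φ) (hm : 3 ≤ m)
    {y : Euc m} (hy : y ∈ φ.target) (h : inner ℝ u y = 0) : fderiv ℝ H y u ≠ 0 := by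
  intro h0
  refine hH.fderiv_ne_zero hφ hm hy (ContinuousLinearMap.ext fun w => ?_)
  rw [hH.fderiv_eq_of_orthogonal hφ hy h, h0]
  simp

/-- On each sphere, `H` is the restriction of a linear function. The reflection in
`u - ⟪e, u⟫ e` fixes `e` and changes the sign of the parallel function `H - ⟪e, u⟫ H ∘ ρ`, where `ρ`
interchanges `e` and `u`, as is seen at a point orthogonal to both. -/
lemma apply_smul (hH : IsOddParallel g φ u H) (hφ : IsRotationalChart g φ) (hm : 3 ≤ m)
    {e : Euc m} (he : ‖e‖ = 1) {r : ℝ} (hr : r • e ∈ φ.target) :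
    H (r • e) = inner ℝ e u * H (r • u) := by
  obtain ⟨y, hy, hyu, hye⟩ := exists_mem_target_orthogonal hφ hm u e
  have hnorm : ‖e‖ = ‖u‖ := he.trans hH.norm_eq.symm
  set ρ := hyperRefl (e - u) with hρ
  set α : ℝ := inner ℝ e u with hα
  set z := u - α • e with hz
  have hρe : ρ e = u := hyperRefl_sub_left hnorm
  have hρu : ρ u = e := hyperRefl_sub_right hnorm
  have hρy : ρ y = y := hyperRefl_of_inner_eq_zero (by rw [inner_sub_left, hye, hyu, sub_zero])
  have hzy : hyperRefl z y = y := hyperRefl_of_inner_eq_zero (by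
    rw [hz, inner_sub_left, inner_smul_left, hye, hyu]; simp)
  have hze : hyperRefl z e = e := hyperRefl_of_inner_eq_zero (by
    rw [hz, inner_sub_left, inner_smul_left, real_inner_self_eq_norm_sq, he, hα,
      real_inner_comm e u]; simp)
  have hHy : H y = 0 := hH.eq_zero_of_orthogonal hyu
  -- The parallel function `K`, its composition with the reflection, and their differentials.
  have hK : IsParallel g φ (fun x => H x - α * H (ρ x)) :=
    hH.isParallel.sub ((hH.isParallel_comp ρ).const_mul α)
  have hKz : IsParallel g φ (fun x => H (hyperRefl z x) - α * H (ρ (hyperRefl z x))) :=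
    (hH.isParallel_comp (hyperRefl z)).sub
      ((hH.isParallel_comp ((hyperRefl z).trans ρ)).const_mul α)
  have hdK : ∀ w, fderiv ℝ (fun x => H x - α * H (ρ x)) y w = fderiv ℝ H y u * inner ℝ z w := by
    intro w
    rw [fderiv_fun_sub (hH.isParallel.differentiableAt hy)
      (((hH.isParallel_comp ρ).const_mul α).differentiableAt hy),
      fderiv_const_mul ((hH.isParallel_comp ρ).differentiableAt hy)]
    simp only [sub_apply, smul_apply, smul_eq_mul]
    rw [hH.fderiv_comp hφ ρ hy, hρy, hH.fderiv_eq_of_orthogonal hφ hy hyu w,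
      hH.fderiv_eq_of_orthogonal hφ hy hyu (ρ w), hρ, ← inner_hyperRefl_left, ← hρ, hρu, hz,
      inner_sub_left, inner_smul_left]
    simp only [conj_trivial]
    ring
  have hdKz : ∀ w, fderiv ℝ (fun x => H (hyperRefl z x) - α * H (ρ (hyperRefl z x))) y w =
      fderiv ℝ (fun x => H x - α * H (ρ x)) y (hyperRefl z w) := by
    intro w
    have h1 : DifferentiableAt ℝ (fun x => H x - α * H (ρ x)) (hyperRefl z y) := by
      rw [hzy]; exact hK.differentiableAt hy
    have h2 : HasFDerivAt (fun x => H (hyperRefl z x) - α * H (ρ (hyperRefl z x))) _ y :=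
      h1.hasFDerivAt.comp y
        ((hyperRefl z).toContinuousLinearEquiv : Euc m →L[ℝ] Euc m).hasFDerivAt
    rw [h2.fderiv, hzy]
    rfl
  have key := hKz.eqOn hφ.mem_maximalAtlas (hφ.isPreconnected_target hm) (hK.const_mul (-1)) hy
    (by simp only [hzy, hρy, hHy]; ring) (fun w => by
      rw [hdKz, hdK, ← inner_hyperRefl_left, hyperRefl_self,
        fderiv_const_mul (hK.differentiableAt hy)]
      simp only [smul_apply, smul_eq_mul, hdK, inner_neg_left]
      ring) hr
  simp only [map_smul, hze, hρe] at key
  linarith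

/-- `H` is invariant under the reflections that fix the axis `u`. -/
lemma apply_hyperRefl (hH : IsOddParallel g φ u H) (hφ : IsRotationalChart g φ) (hm : 3 ≤ m)
    {v y : Euc m} (hv : inner ℝ v u = 0) (hy : y ∈ φ.target) : H (hyperRefl v y) = H y := by
  by_cases h0 : y = 0
  · simp [h0]
  have hn : ‖y‖ ≠ 0 := norm_ne_zero_iff.2 h0
  have he : ‖‖y‖⁻¹ • y‖ = 1 := norm_smul_inv_norm h0
  have hye : y = ‖y‖ • (‖y‖⁻¹ • y) := by rw [smul_smul, mul_inv_cancel₀ hn, one_smul]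
  have hy' : ‖y‖ • (‖y‖⁻¹ • y) ∈ φ.target := hye ▸ hy
  have h1 := hH.apply_smul hφ hm he hy'
  have h2 := hH.apply_smul hφ hm (e := hyperRefl v (‖y‖⁻¹ • y)) (r := ‖y‖)
    (by rw [LinearIsometryEquiv.norm_map, he])
    (by rw [← map_smul]; exact hφ.map_mem_target _ hy')
  rw [← map_smul, inner_hyperRefl_left, hyperRefl_of_inner_eq_zero hv, ← h1, ← hye] at h2
  exact h2

lemma fderiv_axis (hH : IsOddParallel g φ u H) (hφ : IsRotationalChart g φ) (hm : 3 ≤ m)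
    {r : ℝ} (hr : r • u ∈ φ.target) (w : Euc m) :
    fderiv ℝ H (r • u) w = fderiv ℝ H (r • u) u * inner ℝ u w := by
  set v := w - (inner ℝ u w : ℝ) • u with hv
  have hvu : inner ℝ v u = 0 := by
    rw [hv, inner_sub_left, inner_smul_left, real_inner_self_eq_norm_sq, hH.norm_eq,
      real_inner_comm u w]; simp
  have h1 := hH.fderiv_comp hφ (hyperRefl v) hr v
  have h2 : fderiv ℝ (fun x => H (hyperRefl v x)) (r • u) = fderiv ℝ H (r • u) := by
    refine Filter.EventuallyEq.fderiv_eq ?_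
    filter_upwards [φ.open_target.mem_nhds hr] with x hx using hH.apply_hyperRefl hφ hm hvu hx
  rw [h2, map_smul, hyperRefl_of_inner_eq_zero hvu, hyperRefl_self, map_neg] at h1
  have h3 : fderiv ℝ H (r • u) v = 0 := by linarith
  rw [hv, map_sub, map_smul, smul_eq_mul] at h3
  linarith

/-- Along the axis `u`, the gradient of `H` is radial, which determines its length. -/
lemma gradInner_axis (hH : IsOddParallel g φ u H) (hφ : IsRotationalChart g φ) (hm : 3 ≤ m)
    {r : ℝ} (hr : r • u ∈ φ.target) :
    gradInner g φ H H (r • u) * chartMetric g φ (r • u) u u = fderiv ℝ H (r • u) u ^ 2 := by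
  have hu0 : u ≠ 0 := by rintro rfl; simpa using hH.norm_eq
  set b := chartMetric g φ (r • u) u u with hb
  set s := fderiv ℝ H (r • u) u with hs
  have hb0 : b ≠ 0 := (chartMetric_pos g hφ.mem_maximalAtlas hr hu0).ne'
  have hd : ∀ i, partialD i H (r • u) = s * u i := by
    intro i
    rw [partialD, hH.fderiv_axis hφ hm hr]
    simp [hs, EuclideanSpace.inner_single_right]
  have hX : chartGradient g φ H (r • u) = fun i => s / b * u i := by
    refine chartGradient_eq_of_mulVec hφ.mem_maximalAtlas hr fun i => ?_
    have h1 := hφ.chartMetric_axis hm hH.norm_eq hr (EuclideanSpace.single i 1)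
    rw [chartMetric_eq_sum, ← hb] at h1
    have h2 : ∑ j, metricCoeff g φ (r • u) i j * u j = u i * b := by
      rw [Finset.sum_eq_single i (by intro k _ hk; simp [hk]) (by simp)] at h1
      simpa [EuclideanSpace.inner_single_right] using h1
    calc ∑ j, metricCoeff g φ (r • u) i j * (s / b * u j)
        = s / b * ∑ j, metricCoeff g φ (r • u) i j * u j := by
          rw [Finset.mul_sum]; exact Finset.sum_congr rfl fun j _ => by ring
      _ = partialD i H (r • u) := by rw [h2, hd]; field_simp
  have hun : ∑ i, u i * u i = 1 := by
    have := real_inner_self_eq_norm_sq u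
    rw [hH.norm_eq, PiLp.inner_apply] at this
    simpa [sq] using this
  have hQ : gradInner g φ H H (r • u) = s ^ 2 / b := by
    rw [gradInner, hX]
    simp only [hd]
    calc ∑ i, s / b * u i * (s * u i) = s ^ 2 / b * ∑ i, u i * u i := by
          rw [Finset.mul_sum]; exact Finset.sum_congr rfl fun j _ => by ring
      _ = s ^ 2 / b := by rw [hun, mul_one]
  rw [hQ]
  field_simp

/-- The constant `κ` is the length of the gradient of `H`. -/
lemma exists_speed (hH : IsOddParallel g φ u H) (hφ : IsRotationalChart g φ) (hm : 3 ≤ m) :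
    ∃ κ : ℝ, 0 < κ ∧ ∀ r : ℝ, r • u ∈ φ.target →
      fderiv ℝ H (r • u) u ^ 2 = κ ^ 2 * chartMetric g φ (r • u) u u := by
  obtain ⟨y, hy, -⟩ := exists_mem_target_orthogonal hφ hm u u
  have hpos : 0 < gradInner g φ H H y := by
    rw [gradInner_self_eq hφ.mem_maximalAtlas hy]
    refine chartMetric_pos g hφ.mem_maximalAtlas hy fun h => hH.fderiv_ne_zero hφ hm hy ?_
    refine fderiv_eq_zero_of_gradInner_self (g := g) hφ.mem_maximalAtlas hy ?_
    rw [gradInner_self_eq hφ.mem_maximalAtlas hy, h]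
    simp
  have h1 : ∀ x ∈ φ.target, gradInner g φ H H x = √(gradInner g φ H H y) ^ 2 := fun x hx => by
    rw [Real.sq_sqrt hpos.le]
    exact hH.isParallel.gradInner_eq hφ.mem_maximalAtlas (hφ.isPreconnected_target hm)
      hH.isParallel hx hy
  exact ⟨√(gradInner g φ H H y), Real.sqrt_pos.2 hpos,
    fun r hr => by rw [← hH.gradInner_axis hφ hm hr, h1 _ hr]⟩

lemma hasDerivAt_axis (hH : IsOddParallel g φ u H) {r : ℝ} (hr : r • u ∈ φ.target) :
    HasDerivAt (fun t : ℝ => H (t • u)) (fderiv ℝ H (r • u) u) r := by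
  have h1 : HasDerivAt (fun t : ℝ => t • u) u r := by
    simpa using (hasDerivAt_id r).smul_const u
  exact (hH.isParallel.differentiableAt hr).hasFDerivAt.comp_hasDerivAt r h1

lemma fderiv_axis_ne_zero (hH : IsOddParallel g φ u H) (hφ : IsRotationalChart g φ) (hm : 3 ≤ m)
    {r : ℝ} (hr : r • u ∈ φ.target) : fderiv ℝ H (r • u) u ≠ 0 := by
  intro h
  refine hH.fderiv_ne_zero hφ hm hr (ContinuousLinearMap.ext fun w => ?_)
  rw [hH.fderiv_axis hφ hm hr, h]
  simp

/-- `H` does not vanish on the axis away from the origin: otherwise it would vanish on a sphere,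
against the size of its differential at the points of the sphere orthogonal to `u`. -/
lemma apply_axis_ne_zero (hH : IsOddParallel g φ u H) (hφ : IsRotationalChart g φ) (hm : 3 ≤ m)
    {r : ℝ} (hr : 0 < r) : H (r • u) ≠ 0 := by
  intro h0
  obtain ⟨z, hz, hzu, -⟩ := exists_unit_orthogonal hm u u
  have hzero : ∀ y : Euc m, ‖y‖ = r → H y = 0 := by
    intro y hy
    have hy0 : y ≠ 0 := by rintro rfl; simp at hy; exact hr.ne hy
    have hye : y = r • (‖y‖⁻¹ • y) := by rw [hy, smul_smul, mul_inv_cancel₀ hr.ne', one_smul]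
    have he : ‖‖y‖⁻¹ • y‖ = 1 := norm_smul_inv_norm hy0
    rw [hye, hH.apply_smul hφ hm he (hye ▸ hφ.mem_target y hy0), h0, mul_zero]
  have hrz : r • z ∈ φ.target := hφ.mem_target _ (smul_ne_zero hr.ne' (by rintro rfl; simp at hz))
  -- The circle through `r z` in the direction of `u`.
  let c : ℝ → Euc m := fun t => r • (Real.cos t • z + Real.sin t • u)
  have hc : HasDerivAt c (r • u) 0 := by
    have h1 := ((Real.hasDerivAt_cos 0).smul_const z).fun_add ((Real.hasDerivAt_sin 0).smul_const u)
    have h2 : r • u = r • (-Real.sin 0 • z + Real.cos 0 • u) := by simp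
    rw [h2]
    exact h1.fun_const_smul r
  have hc0 : c 0 = r • z := by simp [c]
  have hcn : ∀ t, ‖c t‖ = r := by
    intro t
    have h1 : ‖Real.cos t • z + Real.sin t • u‖ ^ 2 = 1 := by
      rw [norm_add_sq_real, norm_smul, norm_smul, hz, hH.norm_eq, inner_smul_left, inner_smul_right,
        real_inner_comm, hzu]
      simp
    have h2 : ‖Real.cos t • z + Real.sin t • u‖ = 1 :=
      (pow_eq_one_iff_of_nonneg (norm_nonneg _) two_ne_zero).1 h1
    rw [norm_smul, h2, mul_one, Real.norm_of_nonneg hr.le]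
  have h1 : HasDerivAt (fun t => H (c t)) (fderiv ℝ H (r • z) (r • u)) 0 := by
    have := hH.isParallel.differentiableAt hrz
    rw [← hc0] at this ⊢
    exact this.hasFDerivAt.comp_hasDerivAt 0 hc
  have h2 : (fun t => H (c t)) = fun _ => 0 := funext fun t => hzero _ (hcn t)
  rw [h2] at h1
  have h3 := h1.unique (hasDerivAt_const (0 : ℝ) (0 : ℝ))
  rw [map_smul, smul_eq_mul] at h3
  exact hH.fderiv_self_ne_zero hφ hm hrz (by rw [inner_smul_right, hzu, mul_zero])
    ((mul_eq_zero.1 h3).resolve_left hr.ne')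

end IsOddParallel
end OddParallel

/-! ### Completeness along radial lines -/

section Completeness

variable {m : ℕ} {M : Type*} [TopologicalSpace M] [ChartedSpace (Euc m) M]
  [IsManifold (𝓡 m) ∞ M] {g : SmoothMetric m M} {φ : OpenPartialHomeomorph M (Euc m)}

/-- The distance between two points of a line through the origin is at most the increment of a
function `T` that has the same speed as the line. -/
lemma metricDist_line_le (hφ : φ ∈ IsManifold.maximalAtlas (𝓡 m) ∞ M) {u : Euc m} {a b : ℝ}
    (hab : a ≤ b) (hline : ∀ t ∈ Set.Icc a b, t • u ∈ φ.target) {T T' : ℝ → ℝ}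
    (hT : ∀ t ∈ Set.Icc a b, HasDerivAt T (T' t) t) (hT' : ContinuousOn T' (Set.Icc a b))
    (hnonneg : ∀ t ∈ Set.Icc a b, 0 ≤ T' t)
    (hspeed : ∀ t ∈ Set.Icc a b, chartMetric g φ (t • u) u u = T' t ^ 2) :
    metricDist g (φ.symm (a • u)) (φ.symm (b • u)) ≤ ENNReal.ofReal (T b - T a) := by
  let : Bundle.RiemannianBundle (fun x : M => TangentSpace (𝓡 m) x) := ⟨g.toRiemannianMetric⟩
  let γ : ℝ → M := fun t => φ.symm (t • u)
  have hlin : ContDiff ℝ ∞ (fun t : ℝ => t • u) := contDiff_id.smul contDiff_const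
  have hγ : ∀ t ∈ Set.Icc a b, ContMDiffAt 𝓘(ℝ, ℝ) (𝓡 m) ∞ γ t := fun t ht =>
    ContMDiffAt.comp t (contMDiffAt_symm_of_mem_maximalAtlas hφ (hline t ht))
      hlin.contMDiff.contMDiffAt
  have hnorm : ∀ t ∈ Set.Icc a b, ‖mfderiv 𝓘(ℝ, ℝ) (𝓡 m) γ t 1‖ₑ = ENNReal.ofReal (T' t) := by
    intro t ht
    have h1 := mfderiv_comp t (mdifferentiableAt_symm_of_mem_maximalAtlas
      (mem_maximalAtlas_one hφ) (hline t ht))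
      (hlin.contMDiff.mdifferentiable (by simp)).mdifferentiableAt
    have h2 : mfderiv 𝓘(ℝ, ℝ) (𝓡 m) (fun t : ℝ => t • u) t 1 = u := by
      rw [mfderiv_eq_fderiv]
      have : HasDerivAt (fun t : ℝ => t • u) u t := by simpa using (hasDerivAt_id t).smul_const u
      exact this.deriv
    have h3 : mfderiv 𝓘(ℝ, ℝ) (𝓡 m) γ t 1 = mfderiv (𝓡 m) (𝓡 m) φ.symm (t • u) u := by
      have h4 : mfderiv 𝓘(ℝ, ℝ) (𝓡 m) γ t = _ := h1
      rw [h4]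
      exact congrArg (mfderiv (𝓡 m) (𝓡 m) φ.symm (t • u)) h2
    rw [h3]
    have h5 : ‖mfderiv (𝓡 m) (𝓡 m) φ.symm (t • u) u‖ ^ 2 = T' t ^ 2 := by
      rw [← hspeed t ht, ← real_inner_self_eq_norm_sq]
      rfl
    have h6 : ‖mfderiv (𝓡 m) (𝓡 m) φ.symm (t • u) u‖ = T' t :=
      (pow_left_inj₀ (norm_nonneg _) (hnonneg t ht) two_ne_zero).1 h5
    rw [← ofReal_norm, h6]
  have hint : IntervalIntegrable T' MeasureTheory.volume a b :=
    ContinuousOn.intervalIntegrable (by rwa [Set.uIcc_of_le hab])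
  calc metricDist g (φ.symm (a • u)) (φ.symm (b • u))
      ≤ Manifold.pathELength (𝓡 m) γ a b :=
        Manifold.riemannianEDist_le_pathELength
          (fun t ht => ((hγ t ht).of_le (by simp)).contMDiffWithinAt) rfl rfl hab
    _ = ∫⁻ t in Set.Icc a b, ENNReal.ofReal (T' t) := by
        rw [Manifold.pathELength_eq_lintegral_mfderiv_Icc]
        exact MeasureTheory.setLIntegral_congr_fun measurableSet_Icc hnorm
    _ = ENNReal.ofReal (∫ t in Set.Icc a b, T' t) := by
        rw [MeasureTheory.ofReal_integral_eq_lintegral_ofReal]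
        · exact hT'.integrableOn_Icc
        · exact (MeasureTheory.ae_restrict_iff' measurableSet_Icc).2 (.of_forall hnonneg)
    _ = ENNReal.ofReal (T b - T a) := by
        rw [MeasureTheory.integral_Icc_eq_integral_Ioc, ← intervalIntegral.integral_of_le hab,
          intervalIntegral.integral_eq_sub_of_hasDerivAt
            (fun t ht => hT t (by rwa [Set.uIcc_of_le hab] at ht)) hint]

lemma metricDist_comm (g : SmoothMetric m M) (x y : M) : metricDist g x y = metricDist g y x := by
  let : Bundle.RiemannianBundle (fun x : M => TangentSpace (𝓡 m) x) := ⟨g.toRiemannianMetric⟩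
  exact Manifold.riemannianEDist_comm

/-- If the metric is complete and the arc length along a radial line converges along a sequence of
points of the line, then the sequence converges to a point of the chart. -/
lemma exists_tendsto_of_cauchySeq (hcomplete : IsCompleteMetric g)
    (hφ : φ ∈ IsManifold.maximalAtlas (𝓡 m) ∞ M) (hsource : φ.source = Set.univ) {u : Euc m}
    {s : Set ℝ} (hs : s.OrdConnected) (hline : ∀ t ∈ s, t • u ∈ φ.target) {T T' : ℝ → ℝ}
    (hT : ∀ t ∈ s, HasDerivAt T (T' t) t) (hT' : ContinuousOn T' s) (hnonneg : ∀ t ∈ s, 0 ≤ T' t)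
    (hspeed : ∀ t ∈ s, chartMetric g φ (t • u) u u = T' t ^ 2) {t : ℕ → ℝ} (ht : ∀ k, t k ∈ s)
    (hcauchy : CauchySeq fun k => T (t k)) :
    ∃ y ∈ φ.target, Filter.Tendsto (fun k => t k • u) Filter.atTop (𝓝 y) := by
  have hle : ∀ a ∈ s, ∀ b ∈ s, a ≤ b →
      metricDist g (φ.symm (a • u)) (φ.symm (b • u)) ≤ ENNReal.ofReal |T b - T a| := by
    intro a ha b hb hab
    have hsub : Set.Icc a b ⊆ s := hs.out ha hb
    exact (metricDist_line_le hφ hab (fun t h => hline t (hsub h)) (fun t h => hT t (hsub h))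
      (hT'.mono hsub) (fun t h => hnonneg t (hsub h)) (fun t h => hspeed t (hsub h))).trans
      (ENNReal.ofReal_le_ofReal (le_abs_self _))
  have hdist : ∀ a ∈ s, ∀ b ∈ s,
      metricDist g (φ.symm (a • u)) (φ.symm (b • u)) ≤ ENNReal.ofReal |T b - T a| := by
    intro a ha b hb
    rcases le_total a b with h | h
    · exact hle a ha b hb h
    · rw [metricDist_comm, abs_sub_comm]
      exact hle b hb a ha h
  obtain ⟨x, hx⟩ := hcomplete (fun k => φ.symm (t k • u)) fun ε hε => by
    rcases eq_or_ne ε ⊤ with rfl | hε'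
    · exact ⟨0, fun j _ k _ => (hdist _ (ht j) _ (ht k)).trans_lt ENNReal.ofReal_lt_top⟩
    obtain ⟨N, hN⟩ := Metric.cauchySeq_iff.1 hcauchy ε.toReal (ENNReal.toReal_pos hε.ne' hε')
    refine ⟨N, fun j hj k hk => (hdist _ (ht j) _ (ht k)).trans_lt ?_⟩
    rw [ENNReal.ofReal_lt_iff_lt_toReal (abs_nonneg _) hε']
    exact hN k hk j hj
  have hxs : x ∈ φ.source := hsource ▸ Set.mem_univ x
  refine ⟨φ x, φ.map_source hxs, ((φ.continuousAt hxs).tendsto.comp hx).congr fun k => ?_⟩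
  exact φ.right_inv (hline _ (ht k))

end Completeness

/-! ### Arc length along the axis -/

section Axis

variable {m : ℕ} {M : Type*} [TopologicalSpace M] [ChartedSpace (Euc m) M]
  [IsManifold (𝓡 m) ∞ M] {g : SmoothMetric m M} {φ : OpenPartialHomeomorph M (Euc m)}
  {u : Euc m} {H : Euc m → ℝ}

namespace IsOddParallel

lemma continuousOn_fderiv_axis (hH : IsOddParallel g φ u H) {s : Set ℝ}
    (hs : ∀ t ∈ s, t • u ∈ φ.target) : ContinuousOn (fun t : ℝ => fderiv ℝ H (t • u) u) s := by
  have h1 : ContinuousOn (fderiv ℝ H) φ.target :=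
    hH.isParallel.contDiffOn.continuousOn_fderiv_of_isOpen φ.open_target (by simp)
  have h2 : ContinuousOn (fun t : ℝ => t • u) s := by fun_prop
  exact (h1.comp h2 hs).clm_apply continuousOn_const

/-- A multiple of `H` is the arc length along a part of the axis: the derivative of `H` along the
axis does not vanish, so its sign is constant. -/
lemma exists_arclength (hH : IsOddParallel g φ u H) (hφ : IsRotationalChart g φ) (hm : 3 ≤ m)
    {s : Set ℝ} (hconv : Convex ℝ s) (hs : ∀ t ∈ s, t • u ∈ φ.target) :
    ∃ c : ℝ, ∀ t ∈ s, 0 < c * fderiv ℝ H (t • u) u ∧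
      chartMetric g φ (t • u) u u = (c * fderiv ℝ H (t • u) u) ^ 2 := by
  obtain ⟨κ, hκ, hspeed⟩ := hH.exists_speed hφ hm
  have hsq : ∀ t ∈ s, chartMetric g φ (t • u) u u = (κ⁻¹ * fderiv ℝ H (t • u) u) ^ 2 := by
    intro t ht
    rw [mul_pow, hspeed t (hs t ht), ← mul_assoc, ← mul_pow, inv_mul_cancel₀ hκ.ne', one_pow,
      one_mul]
  rcases hasDerivWithinAt_forall_lt_or_forall_gt_of_forall_ne hconv
    (fun t ht => (hH.hasDerivAt_axis (hs t ht)).hasDerivWithinAt)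
    (fun t ht => hH.fderiv_axis_ne_zero hφ hm (hs t ht)) with h | h
  · refine ⟨-κ⁻¹, fun t ht => ⟨?_, by rw [hsq t ht]; ring⟩⟩
    rw [neg_mul]
    exact neg_pos.2 (mul_neg_of_pos_of_neg (inv_pos.2 hκ) (h t ht))
  · exact ⟨κ⁻¹, fun t ht => ⟨mul_pos (inv_pos.2 hκ) (h t ht), hsq t ht⟩⟩

/-- For a complete metric, if the arc length along the axis, given by `c H`, is a Cauchy sequence at
some points of the axis, then these points converge in the chart. -/
lemma exists_tendsto_axis (hH : IsOddParallel g φ u H) (hφ : IsRotationalChart g φ)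
    (hcomplete : IsCompleteMetric g) {s : Set ℝ} (hconv : Convex ℝ s)
    (hs : ∀ t ∈ s, t • u ∈ φ.target) {c : ℝ}
    (hc : ∀ t ∈ s, 0 < c * fderiv ℝ H (t • u) u ∧
      chartMetric g φ (t • u) u u = (c * fderiv ℝ H (t • u) u) ^ 2)
    {t : ℕ → ℝ} (ht : ∀ k, t k ∈ s) (hcauchy : CauchySeq fun k => c * H (t k • u)) :
    ∃ y ∈ φ.target, Filter.Tendsto (fun k => t k • u) Filter.atTop (𝓝 y) :=
  exists_tendsto_of_cauchySeq hcomplete hφ.mem_maximalAtlas hφ.source_eq hconv.ordConnected hs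
    (T := fun r => c * H (r • u)) (T' := fun r => c * fderiv ℝ H (r • u) u)
    (fun r hr => (hH.hasDerivAt_axis (hs r hr)).const_mul c)
    (continuousOn_const.mul (hH.continuousOn_fderiv_axis hs)) (fun r hr => (hc r hr).1.le)
    (fun r hr => (hc r hr).2) ht hcauchy

lemma strictMonoOn_arclength (hH : IsOddParallel g φ u H) {s : Set ℝ} (hconv : Convex ℝ s)
    (hopen : IsOpen s) (hs : ∀ t ∈ s, t • u ∈ φ.target) {c : ℝ}
    (hc : ∀ t ∈ s, 0 < c * fderiv ℝ H (t • u) u) : StrictMonoOn (fun t => c * H (t • u)) s := by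
  have hd : ∀ t ∈ s, HasDerivAt (fun t : ℝ => c * H (t • u)) (c * fderiv ℝ H (t • u) u) t :=
    fun t ht => (hH.hasDerivAt_axis (hs t ht)).const_mul c
  refine strictMonoOn_of_deriv_pos hconv (fun t ht => (hd t ht).continuousAt.continuousWithinAt)
    fun t ht => ?_
  rw [hopen.interior_eq] at ht
  rw [(hd t ht).deriv]
  exact hc t ht

end IsOddParallel

lemma cauchySeq_of_monotone_of_le {T : ℕ → ℝ} (hT : Monotone T) {C : ℝ} (hC : ∀ k, T k ≤ C) :
    CauchySeq T :=
  (tendsto_atTop_ciSup hT ⟨C, by rintro _ ⟨k, rfl⟩; exact hC k⟩).cauchySeq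

lemma not_tendsto_smul_of_atTop {u : Euc m} (hu : ‖u‖ = 1) {t : ℕ → ℝ}
    (ht : Filter.Tendsto t Filter.atTop Filter.atTop) (y : Euc m) :
    ¬ Filter.Tendsto (fun k => t k • u) Filter.atTop (𝓝 y) := by
  intro h
  have h1 := h.norm
  simp only [norm_smul, hu, mul_one] at h1
  exact not_tendsto_nhds_of_tendsto_atTop (Filter.tendsto_abs_atTop_atTop.comp ht) _ h1

/-- A complete rotation-invariant metric on `ℝᵐ \ {0}` admits no odd function with vanishing
Hessian: the function does not vanish along a radial ray, where it is monotone and measures arc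
length, so that one of the two ends of the ray is at finite distance. -/
lemma IsRotationalChart.false_of_isOddParallel (hφ : IsRotationalChart g φ) (hm : 3 ≤ m)
    (hcomplete : IsCompleteMetric g) (h0 : (0 : Euc m) ∉ φ.target) (hH : IsOddParallel g φ u H) :
    False := by
  have hu0 : u ≠ 0 := by rintro rfl; simpa using hH.norm_eq
  have hs : ∀ t ∈ Set.Ioi (0 : ℝ), t • u ∈ φ.target :=
    fun t ht => hφ.mem_target _ (smul_ne_zero (ne_of_gt ht) hu0)
  have hconv : Convex ℝ (Set.Ioi (0 : ℝ)) := convex_Ioi 0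
  obtain ⟨c, hc⟩ := hH.exists_arclength hφ hm hconv hs
  have hmono := hH.strictMonoOn_arclength hconv isOpen_Ioi hs fun t ht => (hc t ht).1
  have hc0 : c ≠ 0 := by
    rintro rfl
    simpa using (hc 1 (Set.mem_Ioi.2 one_pos)).1
  have hne : ∀ t ∈ Set.Ioi (0 : ℝ), c * H (t • u) ≠ 0 :=
    fun t ht => mul_ne_zero hc0 (hH.apply_axis_ne_zero hφ hm ht)
  have hcont : ContinuousOn (fun t : ℝ => c * H (t • u)) (Set.Ioi 0) := fun t ht =>
    ((hH.hasDerivAt_axis (hs t ht)).const_mul c).continuousAt.continuousWithinAt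
  have hsign : (∀ t ∈ Set.Ioi (0 : ℝ), 0 < c * H (t • u)) ∨
      ∀ t ∈ Set.Ioi (0 : ℝ), c * H (t • u) < 0 := by
    by_contra hcon
    push Not at hcon
    obtain ⟨⟨a, ha, ha'⟩, b, hb, hb'⟩ := hcon
    obtain ⟨x, hx, hx'⟩ := isPreconnected_Ioi.intermediate_value ha hb hcont ⟨ha', hb'⟩
    exact hne x hx hx'
  rcases hsign with h | h
  -- The arc length is bounded below: the points `u / (k + 1)` converge to the missing origin.
  · have hpos : ∀ k : ℕ, (1 / ((k : ℝ) + 1)) ∈ Set.Ioi (0 : ℝ) :=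
      fun k => Set.mem_Ioi.2 Nat.one_div_pos_of_nat
    have hcauchy : CauchySeq fun k : ℕ => c * H ((1 / ((k : ℝ) + 1)) • u) := by
      have := cauchySeq_of_monotone_of_le (T := fun k : ℕ => -(c * H ((1 / ((k : ℝ) + 1)) • u)))
        (C := 0) (fun i j hij => neg_le_neg (hmono.monotoneOn (hpos j) (hpos i)
          (Nat.one_div_le_one_div hij))) (fun k => (neg_neg_of_pos (h _ (hpos k))).le)
      simpa only [Pi.neg_def, neg_neg] using this.neg
    obtain ⟨y, hy, hlim⟩ := hH.exists_tendsto_axis hφ hcomplete hconv hs hc hpos hcauchy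
    have hlim0 : Filter.Tendsto (fun k : ℕ => (1 / ((k : ℝ) + 1)) • u) Filter.atTop (𝓝 0) := by
      simpa using (tendsto_one_div_add_atTop_nhds_zero_nat (𝕜 := ℝ)).smul_const u
    exact h0 (tendsto_nhds_unique hlim hlim0 ▸ hy)
  -- The arc length is bounded above: the points `(k + 1) u` have no limit.
  · have hpos : ∀ k : ℕ, (k : ℝ) + 1 ∈ Set.Ioi (0 : ℝ) := fun k => Set.mem_Ioi.2 (by positivity)
    have hcauchy : CauchySeq fun k : ℕ => c * H (((k : ℝ) + 1) • u) :=
      cauchySeq_of_monotone_of_le (C := 0) (fun i j hij => hmono.monotoneOn (hpos i) (hpos j)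
        (by gcongr)) (fun k => (h _ (hpos k)).le)
    obtain ⟨y, hy, hlim⟩ := hH.exists_tendsto_axis hφ hcomplete hconv hs hc hpos hcauchy
    exact not_tendsto_smul_of_atTop hH.norm_eq
      (Filter.tendsto_atTop_add_const_right _ 1 tendsto_natCast_atTop_atTop) y hlim

end Axis

/-! ### The flat case -/

section Flat

variable {m : ℕ} {M : Type*} [TopologicalSpace M] [ChartedSpace (Euc m) M]
  [IsManifold (𝓡 m) ∞ M] {g : SmoothMetric m M} {φ : OpenPartialHomeomorph M (Euc m)}
  {u : Euc m} {H : Euc m → ℝ}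

/-- The map whose components are the images of `c H` under isometries that move the coordinate
axes to the axis of `H`. -/
def developingMap (c : ℝ) (u : Euc m) (H : Euc m → ℝ) (y : Euc m) : Euc m :=
  WithLp.toLp 2 fun i => c * H (hyperRefl (EuclideanSpace.single i 1 - u) y)

namespace IsOddParallel

lemma isParallel_developingMap (hH : IsOddParallel g φ u H) (c : ℝ) (i : Fin m) :
    IsParallel g φ (fun y => developingMap c u H y i) :=
  (hH.isParallel_comp _).const_mul c

lemma developingMap_smul (hH : IsOddParallel g φ u H) (hφ : IsRotationalChart g φ) (hm : 3 ≤ m)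
    (c : ℝ) {e : Euc m} (he : ‖e‖ = 1) {r : ℝ} (hr : r • e ∈ φ.target) :
    developingMap c u H (r • e) = (c * H (r • u)) • e := by
  ext i
  have hn : ‖(EuclideanSpace.single i (1 : ℝ) : Euc m)‖ = ‖u‖ := by simp [hH.norm_eq]
  have h1 := hH.apply_smul hφ hm (e := hyperRefl (EuclideanSpace.single i 1 - u) e) (r := r)
    (by rw [LinearIsometryEquiv.norm_map, he])
    (by rw [← map_smul]; exact hφ.map_mem_target _ hr)
  rw [inner_hyperRefl_left, hyperRefl_sub_right hn, ← map_smul] at h1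
  simp only [developingMap, h1, PiLp.smul_apply, smul_eq_mul]
  simp [EuclideanSpace.inner_single_right]
  ring

/-- At the origin, the gradients of the components of the developing map are orthonormal. -/
lemma gradInner_developingMap_zero (hH : IsOddParallel g φ u H) (hφ : IsRotationalChart g φ)
    (hm : 3 ≤ m) (h0 : (0 : Euc m) ∈ φ.target) {c : ℝ}
    (hc : chartMetric g φ 0 u u = (c * fderiv ℝ H 0 u) ^ 2) (i j : Fin m) :
    gradInner g φ (fun y => developingMap c u H y i) (fun y => developingMap c u H y j) 0 =
      if i = j then 1 else 0 := by
  set s := c * fderiv ℝ H 0 u with hs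
  have hu0 : u ≠ 0 := by rintro rfl; simpa using hH.norm_eq
  have hs0 : s ≠ 0 := by
    intro h
    have := chartMetric_pos g hφ.mem_maximalAtlas h0 hu0
    rw [hc, h] at this
    simp at this
  have hd : ∀ i k, partialD k (fun y => developingMap c u H y i) 0 = if k = i then s else 0 := by
    intro i k
    have hn : ‖(EuclideanSpace.single i (1 : ℝ) : Euc m)‖ = ‖u‖ := by simp [hH.norm_eq]
    have h1 : (fun y => developingMap c u H y i) =
        fun y => c * H (hyperRefl (EuclideanSpace.single i 1 - u) y) := rfl
    rw [h1, partialD_const_mul ((hH.isParallel_comp _).differentiableAt h0), partialD,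
      hH.fderiv_comp hφ _ h0, map_zero, hH.fderiv_eq_of_orthogonal hφ h0 (inner_zero_right u),
      ← inner_hyperRefl_left, hyperRefl_sub_right hn, ← mul_assoc, ← hs]
    simp [EuclideanSpace.inner_single_right, eq_comm]
  have hG : ∀ i k, metricCoeff g φ 0 i k = if i = k then s ^ 2 else 0 := by
    intro i k
    have hn : ‖(EuclideanSpace.single k (1 : ℝ) : Euc m)‖ = 1 := by simp
    have h1 := hφ.chartMetric_axis hm hn (r := 0) (by simpa using h0) (EuclideanSpace.single i 1)
    have h2 := hφ.isometry_invariant hm (hyperRefl (EuclideanSpace.single k 1 - u)) h0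
      (EuclideanSpace.single k 1) (EuclideanSpace.single k 1)
    rw [hyperRefl_sub_left (hn.trans hH.norm_eq.symm), map_zero, hc] at h2
    rw [zero_smul, ← h2] at h1
    rw [metricCoeff_eq, h1]
    simp [EuclideanSpace.inner_single_right]
  have hX : chartGradient g φ (fun y => developingMap c u H y i) 0 =
      fun k => if k = i then s⁻¹ else 0 := by
    refine chartGradient_eq_of_mulVec hφ.mem_maximalAtlas h0 fun k => ?_
    rw [hd]
    simp only [hG, ite_mul, zero_mul, Finset.sum_ite_eq, Finset.mem_univ, if_true]
    split_ifs
    · field_simp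
    · simp
  rw [gradInner, hX]
  simp only [hd, ite_mul, zero_mul, Finset.sum_ite_eq', Finset.mem_univ, if_true]
  split_ifs
  · exact inv_mul_cancel₀ hs0
  · simp

/-- The developing map pulls the Euclidean metric back to the given metric. -/
lemma chartMetric_eq_inner_developingMap (hH : IsOddParallel g φ u H) (hφ : IsRotationalChart g φ)
    (hm : 3 ≤ m) (h0 : (0 : Euc m) ∈ φ.target) {c : ℝ}
    (hc : chartMetric g φ 0 u u = (c * fderiv ℝ H 0 u) ^ 2) {y : Euc m} (hy : y ∈ φ.target)
    (v w : Euc m) : chartMetric g φ y v w =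
      ∑ i, fderiv ℝ (fun z => developingMap c u H z i) y v *
        fderiv ℝ (fun z => developingMap c u H z i) y w := by
  -- Orthonormality of the gradients at `y` reads `N G⁻¹ Nᵀ = 1`, which is equivalent to `Nᵀ N = G`.
  let N : Matrix (Fin m) (Fin m) ℝ := fun i k => partialD k (fun z => developingMap c u H z i) y
  let G := metricCoeff g φ y
  have hgram : N * (G⁻¹ * N.transpose) = 1 := by
    ext i j
    have h1 := (hH.isParallel_developingMap c j).gradInner_eq hφ.mem_maximalAtlas
      (hφ.isPreconnected_target hm) (hH.isParallel_developingMap c i) hy h0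
    rw [hH.gradInner_developingMap_zero hφ hm h0 hc] at h1
    rw [Matrix.one_apply]
    simp only [eq_comm (a := i)]
    rw [← h1, Matrix.mul_apply, gradInner]
    exact Finset.sum_congr rfl fun k _ => mul_comm _ _
  have hdet : IsUnit G.det := (det_metricCoeff_ne_zero g hφ.mem_maximalAtlas hy).isUnit
  have hNN : N.transpose * N = G := by
    have h1 := mul_eq_one_comm.1 hgram
    rw [Matrix.mul_assoc] at h1
    calc N.transpose * N = G * (G⁻¹ * (N.transpose * N)) := by
          rw [← Matrix.mul_assoc, Matrix.mul_nonsing_inv _ hdet, Matrix.one_mul]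
      _ = G := by rw [h1, Matrix.mul_one]
  rw [chartMetric_eq_sum]
  have hGN : ∀ a b, metricCoeff g φ y a b = ∑ i, N i a * N i b := by
    intro a b
    change G a b = _
    rw [← hNN]
    rfl
  simp only [fderiv_apply_eq_sum, hGN, Finset.mul_sum, Finset.sum_mul]
  conv_lhs => rw [Finset.sum_comm]
  conv_rhs => rw [Finset.sum_comm]
  refine Finset.sum_congr rfl fun b _ => ?_
  conv_rhs => rw [Finset.sum_comm]
  refine Finset.sum_congr rfl fun a _ => Finset.sum_congr rfl fun i _ => ?_
  change v a * (N i a * N i b) * w b = v a * N i a * (w b * N i b)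
  ring

/-- For a complete metric, the arc length along the axis takes all real values. -/
lemma surjective_arclength (hH : IsOddParallel g φ u H) (hφ : IsRotationalChart g φ)
    (htarget : φ.target = Set.univ) (hcomplete : IsCompleteMetric g) {c : ℝ}
    (hc : ∀ t : ℝ, 0 < c * fderiv ℝ H (t • u) u ∧
      chartMetric g φ (t • u) u u = (c * fderiv ℝ H (t • u) u) ^ 2) :
    StrictMono (fun t : ℝ => c * H (t • u)) ∧
      Function.Surjective (fun t : ℝ => c * H (t • u)) := by
  have hs : ∀ t ∈ (Set.univ : Set ℝ), t • u ∈ φ.target := fun t _ => htarget ▸ Set.mem_univ _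
  have hmono : StrictMono (fun t : ℝ => c * H (t • u)) :=
    strictMonoOn_univ.1 (hH.strictMonoOn_arclength convex_univ isOpen_univ hs fun t _ => (hc t).1)
  have hcont : Continuous (fun t : ℝ => c * H (t • u)) := continuous_iff_continuousAt.2 fun t =>
    ((hH.hasDerivAt_axis (hs t trivial)).const_mul c).continuousAt
  have hodd : ∀ t : ℝ, c * H (-t • u) = -(c * H (t • u)) := by
    intro t
    have := hH.odd (t • u)
    rw [map_smul, hyperRefl_self, smul_neg, ← neg_smul] at this
    rw [this, mul_neg]
  have hunbounded : ∀ C, ∃ t : ℝ, C < c * H (t • u) := by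
    intro C
    by_contra hcon
    push Not at hcon
    obtain ⟨y, -, hlim⟩ := hH.exists_tendsto_axis hφ hcomplete convex_univ hs (fun t _ => hc t)
      (t := fun k : ℕ => (k : ℝ)) (fun _ => trivial)
      (cauchySeq_of_monotone_of_le (fun i j hij => hmono.monotone (Nat.cast_le.2 hij))
        fun k => hcon k)
    exact not_tendsto_smul_of_atTop hH.norm_eq tendsto_natCast_atTop_atTop y hlim
  refine ⟨hmono, fun C => ?_⟩
  obtain ⟨b, hb⟩ := hunbounded C
  obtain ⟨a, ha⟩ := hunbounded (-C)
  have ha' : c * H (-a • u) ≤ C := by rw [hodd]; linarith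
  exact mem_range_of_exists_le_of_exists_ge hcont ⟨-a, ha'⟩ ⟨b, hb.le⟩

lemma bijective_developingMap (hH : IsOddParallel g φ u H) (hφ : IsRotationalChart g φ)
    (hm : 3 ≤ m) (htarget : φ.target = Set.univ) {c : ℝ}
    (hmono : StrictMono (fun t : ℝ => c * H (t • u)))
    (hsurj : Function.Surjective (fun t : ℝ => c * H (t • u))) :
    Function.Bijective (developingMap c u H) := by
  have hrad : ∀ (r : ℝ) (e : Euc m), ‖e‖ = 1 →
      developingMap c u H (r • e) = (c * H (r • u)) • e :=
    fun r e he => hH.developingMap_smul hφ hm c he (htarget ▸ Set.mem_univ _)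
  have hT0 : c * H ((0 : ℝ) • u) = 0 := by
    rw [zero_smul, hH.eq_zero_of_orthogonal (inner_zero_right u), mul_zero]
  have hpolar : ∀ y : Euc m, ∃ r : ℝ, ∃ e : Euc m, 0 ≤ r ∧ ‖e‖ = 1 ∧ y = r • e := by
    intro y
    by_cases hy : y = 0
    · exact ⟨0, u, le_rfl, hH.norm_eq, by simp [hy]⟩
    · exact ⟨‖y‖, ‖y‖⁻¹ • y, norm_nonneg y, norm_smul_inv_norm hy,
        by rw [smul_smul, mul_inv_cancel₀ (norm_ne_zero_iff.2 hy), one_smul]⟩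
  constructor
  · intro y y' h
    obtain ⟨r, e, hr, he, rfl⟩ := hpolar y
    obtain ⟨r', e', hr', he', rfl⟩ := hpolar y'
    rw [hrad r e he, hrad r' e' he'] at h
    have hnn : ∀ r : ℝ, 0 ≤ r → 0 ≤ c * H (r • u) := fun r hr => hT0 ▸ hmono.monotone hr
    have hn := congrArg norm h
    rw [norm_smul, norm_smul, he, he', mul_one, mul_one, Real.norm_of_nonneg (hnn r hr),
      Real.norm_of_nonneg (hnn r' hr')] at hn
    have hrr : r = r' := hmono.injective hn
    subst hrr
    by_cases hr0 : r = 0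
    · simp [hr0]
    · have : c * H (r • u) ≠ 0 := fun h => hr0 (hmono.injective (h.trans hT0.symm))
      rw [smul_right_injective _ this h]
  · intro y
    obtain ⟨r, e, -, he, rfl⟩ := hpolar y
    obtain ⟨t, ht⟩ := hsurj r
    exact ⟨t • e, by rw [hrad t e he]; exact congrArg (· • e) ht⟩

end IsOddParallel

/-- A complete rotation-invariant metric on `ℝᵐ` that admits an odd function with vanishing
Hessian is flat. -/
lemma IsRotationalChart.exists_isometry (hφ : IsRotationalChart g φ) (hm : 3 ≤ m)
    (hcomplete : IsCompleteMetric g) (htarget : φ.target = Set.univ)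
    (hH : IsOddParallel g φ u H) :
    ∃ Ψ : Euc m ≃ₘ⟮𝓡 m, 𝓡 m⟯ Euc m, ∀ y v w : Euc m,
      chartMetric g φ y v w = inner ℝ (fderiv ℝ Ψ y v) (fderiv ℝ Ψ y w) := by
  have hmem : ∀ y, y ∈ φ.target := fun y => htarget ▸ Set.mem_univ y
  obtain ⟨c, hc⟩ := hH.exists_arclength hφ hm (s := Set.univ) convex_univ fun t _ => hmem _
  replace hc := fun t => hc t trivial
  have hc0 : chartMetric g φ 0 u u = (c * fderiv ℝ H 0 u) ^ 2 := by simpa using (hc 0).2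
  obtain ⟨hmono, hsurj⟩ := hH.surjective_arclength hφ htarget hcomplete hc
  have hbij := hH.bijective_developingMap hφ hm htarget hmono hsurj
  have hsmooth : ContDiff ℝ ∞ (developingMap c u H) := by
    rw [contDiff_euclidean]
    intro i
    have := (hH.isParallel_developingMap c i).contDiffOn
    rwa [htarget, contDiffOn_univ] at this
  have hdiff : ∀ y, HasFDerivAt (developingMap c u H) (fderiv ℝ (developingMap c u H) y) y :=
    fun y => (hsmooth.differentiable (by simp) y).hasFDerivAt
  have hmetric : ∀ y v w : Euc m, chartMetric g φ y v w =
      inner ℝ (fderiv ℝ (developingMap c u H) y v) (fderiv ℝ (developingMap c u H) y w) := by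
    intro y v w
    have hcomp : ∀ (i : Fin m) (x : Euc m), fderiv ℝ (fun z => developingMap c u H z i) y x =
        fderiv ℝ (developingMap c u H) y x i := by
      intro i x
      have h1 : HasFDerivAt (fun z => developingMap c u H z i) _ y :=
        (EuclideanSpace.proj (𝕜 := ℝ) i).hasFDerivAt.comp y (hdiff y)
      rw [h1.fderiv]
      rfl
    rw [hH.chartMetric_eq_inner_developingMap hφ hm (hmem 0) hc0 (hmem y), PiLp.inner_apply]
    refine Finset.sum_congr rfl fun i _ => ?_
    rw [hcomp, hcomp, mul_comm]
    rfl
  have hinj : ∀ y, Function.Injective (fderiv ℝ (developingMap c u H) y) := by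
    intro y
    rw [injective_iff_map_eq_zero]
    intro v hv
    by_contra hv0
    have := chartMetric_pos g hφ.mem_maximalAtlas (hmem y) hv0
    rw [hmetric, hv, inner_zero_left] at this
    exact lt_irrefl _ this
  let D : Euc m → (Euc m ≃L[ℝ] Euc m) := fun y =>
    (LinearEquiv.ofInjectiveEndo (fderiv ℝ (developingMap c u H) y).toLinearMap
      (hinj y)).toContinuousLinearEquiv
  have hD : ∀ y, ((D y : Euc m ≃L[ℝ] Euc m) : Euc m →L[ℝ] Euc m) =
      fderiv ℝ (developingMap c u H) y := fun y => by ext v; rfl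
  have hopen : IsOpenMap (developingMap c u H) :=
    isOpenMap_of_hasStrictFDerivAt_equiv (f' := D) fun y => by
      rw [hD]
      exact hsmooth.contDiffAt.hasStrictFDerivAt (by simp)
  let Θ : Euc m ≃ₜ Euc m :=
    (Equiv.ofBijective _ hbij).toHomeomorphOfContinuousOpen hsmooth.continuous hopen
  have hsymm : ContDiff ℝ ∞ Θ.symm :=
    Θ.contDiff_symm (f₀' := D) (fun y => by rw [hD]; exact hdiff y) hsmooth
  exact ⟨⟨Θ.toEquiv, hsmooth.contMDiff, hsymm.contMDiff⟩, hmetric⟩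

end Flat

/-! ### Charts of the sphere and of the cylinder -/

section ModelCharts

/-- The dimension of `ℝᵏ⁺¹`, in the form by which the smooth structure of `Sᵏ` depends on it. -/
lemma fact_finrank_euc (k : ℕ) : Fact (Module.finrank ℝ (Euc (k + 1)) = k + 1) :=
  ⟨finrank_euclideanSpace_fin⟩

attribute [local instance] fact_finrank_euc

variable {n : ℕ} {M : Type*} [TopologicalSpace M] [ChartedSpace (Euc (n + 1)) M]

lemma contMDiff_sphereMap {k : ℕ} (ρ : Euc (k + 1) ≃ₗᵢ[ℝ] Euc (k + 1)) :
    ContMDiff (𝓡 k) (𝓡 k) ∞ (sphereMap ρ) := by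
  have h : ContMDiff (𝓡 k) 𝓘(ℝ, Euc (k + 1)) ∞ fun x : Sph k => ρ (x : Euc (k + 1)) :=
    ρ.contDiff.contMDiff.comp contMDiff_coe_sphere
  exact h.codRestrict_sphere fun x => by simp

/-- The radial projection of `ℝᵏ⁺¹ \ {0}` to the sphere, with an arbitrary value at the origin. -/
def toSphere {k : ℕ} (y : Euc (k + 1)) : Sph k :=
  if h : y = 0 then ⟨EuclideanSpace.single 0 1, by simp⟩
  else ⟨‖y‖⁻¹ • y, by simpa using norm_smul_inv_norm (𝕜 := ℝ) h⟩

lemma coe_toSphere {k : ℕ} {y : Euc (k + 1)} (h : y ≠ 0) :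
    (toSphere y : Euc (k + 1)) = ‖y‖⁻¹ • y := by simp [toSphere, h]

lemma contMDiffOn_toSphere (k : ℕ) :
    ContMDiffOn (𝓡 (k + 1)) (𝓡 k) ∞ (toSphere (k := k)) {0}ᶜ := by
  intro y hy
  refine ContMDiffAt.contMDiffWithinAt ?_
  let W : TopologicalSpace.Opens (Euc (k + 1)) := ⟨{0}ᶜ, isOpen_compl_singleton⟩
  have h1 : ContMDiff (𝓡 (k + 1)) 𝓘(ℝ, Euc (k + 1)) ∞
      fun x : W => ‖(x : Euc (k + 1))‖⁻¹ • (x : Euc (k + 1)) := by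
    intro x
    have hx : (x : Euc (k + 1)) ≠ 0 := x.2
    have h2 : ContDiffAt ℝ ∞ (fun z : Euc (k + 1) => ‖z‖⁻¹ • z) x :=
      ((contDiffAt_norm ℝ hx).inv (norm_ne_zero_iff.2 hx)).smul contDiffAt_id
    exact h2.contMDiffAt.comp x (contMDiff_subtype_val x)
  have h3 := h1.codRestrict_sphere (n := k) fun x => by
    have hx : (x : Euc (k + 1)) ≠ 0 := x.2
    simpa using norm_smul_inv_norm (𝕜 := ℝ) hx
  have h4 := h3 ⟨y, hy⟩
  rw [← contMDiffAt_subtype_iff (U := W) (x := ⟨y, hy⟩)]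
  refine h4.congr_of_eventuallyEq (Filter.Eventually.of_forall fun x => ?_)
  exact Subtype.ext (coe_toSphere x.2)

/-- The global chart `(r, θ) ↦ eʳ θ` of a cylinder, with target `ℝᵏ⁺¹ \ {0}`. -/
def cylinderChart (Φ : M ≃ₘ⟮𝓡 (n + 1), 𝓘(ℝ, ℝ).prod (𝓡 n)⟯ (ℝ × Sph n)) :
    OpenPartialHomeomorph M (Euc (n + 1)) where
  toFun x := Real.exp (Φ x).1 • ((Φ x).2 : Euc (n + 1))
  invFun y := Φ.symm (Real.log ‖y‖, toSphere y)
  source := Set.univ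
  target := {0}ᶜ
  map_source' x _ := smul_ne_zero (Real.exp_ne_zero _) (ne_zero_of_mem_unit_sphere (Φ x).2)
  map_target' _ _ := trivial
  left_inv' x _ := by
    have h0 : Real.exp (Φ x).1 • ((Φ x).2 : Euc (n + 1)) ≠ 0 :=
      smul_ne_zero (Real.exp_ne_zero _) (ne_zero_of_mem_unit_sphere (Φ x).2)
    have hn : ‖Real.exp (Φ x).1 • ((Φ x).2 : Euc (n + 1))‖ = Real.exp (Φ x).1 := by
      rw [norm_smul, norm_eq_of_mem_sphere, mul_one, Real.norm_of_nonneg (Real.exp_pos _).le]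
    have h1 : toSphere (Real.exp (Φ x).1 • ((Φ x).2 : Euc (n + 1))) = (Φ x).2 := by
      refine Subtype.ext ?_
      rw [coe_toSphere h0, hn, smul_smul, inv_mul_cancel₀ (Real.exp_ne_zero _), one_smul]
    rw [h1, hn, Real.log_exp]
    exact Φ.symm_apply_apply x
  right_inv' y hy := by
    have h0 : y ≠ 0 := hy
    have hn : ‖y‖ ≠ 0 := norm_ne_zero_iff.2 h0
    rw [Φ.apply_symm_apply]
    simp only
    rw [Real.exp_log (norm_pos_iff.2 h0), coe_toSphere h0, smul_smul, mul_inv_cancel₀ hn, one_smul]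
  open_source := isOpen_univ
  open_target := isOpen_compl_singleton
  continuousOn_toFun := by
    have h1 : Continuous fun x => (Φ x).1 := continuous_fst.comp Φ.continuous
    have h2 : Continuous fun x => ((Φ x).2 : Euc (n + 1)) :=
      continuous_subtype_val.comp (continuous_snd.comp Φ.continuous)
    exact ((Real.continuous_exp.comp h1).smul h2).continuousOn
  continuousOn_invFun := by
    refine Φ.symm.continuous.comp_continuousOn (ContinuousOn.prodMk ?_ ?_)
    · exact continuous_norm.continuousOn.log fun y hy => norm_ne_zero_iff.2 hy
    · exact (contMDiffOn_toSphere n).continuousOn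

lemma cylinderChart_symm_rotation (Φ : M ≃ₘ⟮𝓡 (n + 1), 𝓘(ℝ, ℝ).prod (𝓡 n)⟯ (ℝ × Sph n))
    (ρ : Euc (n + 1) ≃ₗᵢ[ℝ] Euc (n + 1)) {y : Euc (n + 1)} (hy : y ∈ (cylinderChart Φ).target) :
    (cylinderChart Φ).symm (ρ y) = Φ.symm ((Φ ((cylinderChart Φ).symm y)).1,
      sphereMap ρ (Φ ((cylinderChart Φ).symm y)).2) := by
  have h0 : y ≠ 0 := hy
  have h1 : ρ y ≠ 0 := by simpa using h0
  have h2 : (cylinderChart Φ).symm y = Φ.symm (Real.log ‖y‖, toSphere y) := rfl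
  have h3 : (cylinderChart Φ).symm (ρ y) = Φ.symm (Real.log ‖ρ y‖, toSphere (ρ y)) := rfl
  rw [h2, h3, Φ.apply_symm_apply, ρ.norm_map]
  congr 2
  refine Subtype.ext ?_
  simp [sphereMap, coe_toSphere h0, coe_toSphere h1]

/-- The action of a linear isometry on the sphere, as a diffeomorphism. -/
def sphereDiffeomorph {k : ℕ} (ρ : Euc (k + 1) ≃ₗᵢ[ℝ] Euc (k + 1)) :
    Sph k ≃ₘ⟮𝓡 k, 𝓡 k⟯ Sph k where
  toFun := sphereMap ρ
  invFun := sphereMap ρ.symm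
  left_inv x := Subtype.ext (ρ.symm_apply_apply x)
  right_inv x := Subtype.ext (ρ.apply_symm_apply x)
  contMDiff_toFun := contMDiff_sphereMap ρ
  contMDiff_invFun := contMDiff_sphereMap ρ.symm

/-- The chart of a manifold diffeomorphic to the sphere by stereographic projection from `-q`. -/
def sphereChart (Φ : M ≃ₘ⟮𝓡 (n + 1), 𝓡 (n + 1)⟯ Sph (n + 1)) (q : Sph (n + 1)) :
    OpenPartialHomeomorph M (Euc (n + 1)) :=
  Φ.toHomeomorph.transOpenPartialHomeomorph (chartAt (Euc (n + 1)) q)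

lemma sphereChart_target (Φ : M ≃ₘ⟮𝓡 (n + 1), 𝓡 (n + 1)⟯ Sph (n + 1)) (q : Sph (n + 1)) :
    (sphereChart Φ q).target = Set.univ :=
  stereographic'_target (n := n + 1) (-q)

lemma mem_sphereChart_source {Φ : M ≃ₘ⟮𝓡 (n + 1), 𝓡 (n + 1)⟯ Sph (n + 1)} {q : Sph (n + 1)}
    {x : M} (h : Φ x ≠ -q) : x ∈ (sphereChart Φ q).source := by
  have h1 : (chartAt (Euc (n + 1)) q).source = {-q}ᶜ := stereographic'_source (n := n + 1) (-q)
  change Φ x ∈ (chartAt (Euc (n + 1)) q).source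
  rw [h1]
  exact h

lemma infinite_sphere (k : ℕ) : Infinite (Sph (k + 1)) := by
  have hrank : 1 < Module.rank ℝ (Euc (k + 2)) := by
    rw [← Module.finrank_eq_rank, finrank_euclideanSpace_fin]
    exact_mod_cast (by omega : 1 < k + 2)
  refine Set.infinite_coe_iff.2 ((isPreconnected_sphere hrank 0 1).infinite_of_nontrivial
    ⟨EuclideanSpace.single 0 1, by simp, -EuclideanSpace.single 0 1, by simp, fun h => ?_⟩)
  have := congrArg (fun v : Euc (k + 2) => v 0) h
  simp at this
  norm_num at this

end ModelCharts

/-! ### Rotationally symmetric metrics on the three models -/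

section Models

attribute [local instance] fact_finrank_euc

variable {n : ℕ} {M : Type*} [TopologicalSpace M] [ChartedSpace (Euc (n + 1)) M]
  [IsManifold (𝓡 (n + 1)) ∞ M] {g : SmoothMetric (n + 1) M}

/-- An isometry that is the linear isometry `ρ` in the coordinates of a chart leaves the metric
invariant under `ρ` there. -/
lemma chartMetric_linear_of_isometry {φ : OpenPartialHomeomorph M (Euc (n + 1))}
    (hφ : φ ∈ IsManifold.maximalAtlas (𝓡 (n + 1)) ∞ M) {τ : M → M}
    (hτ : MDifferentiable (𝓡 (n + 1)) (𝓡 (n + 1)) τ)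
    (hτg : ∀ (x : M) (u v : TangentSpace (𝓡 (n + 1)) x),
      g.inner (τ x) (mfderiv (𝓡 (n + 1)) (𝓡 (n + 1)) τ x u)
        (mfderiv (𝓡 (n + 1)) (𝓡 (n + 1)) τ x v) = g.inner x u v)
    (ρ : Euc (n + 1) ≃ₗᵢ[ℝ] Euc (n + 1)) (hρ : ∀ y ∈ φ.target, ρ y ∈ φ.target)
    (hτρ : ∀ y ∈ φ.target, φ.symm (ρ y) = τ (φ.symm y)) {y : Euc (n + 1)} (hy : y ∈ φ.target)
    (v w : Euc (n + 1)) :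
    chartMetric g φ (ρ y) (ρ v) (ρ w) = chartMetric g φ y v w := by
  rw [← chartMetric_transHomeomorph hφ ρ (hρ y hy)]
  exact chartMetric_eq_of_isometry g hφ hτ hτg hτρ hy v w

lemma StandardModel.SymmetricMetric.isRotationalChart_euclidean
    {Φ : M ≃ₘ⟮𝓡 (n + 1), 𝓡 (n + 1)⟯ Euc (n + 1)}
    (hsym : (StandardModel.euclidean Φ).SymmetricMetric g) :
    IsRotationalChart g Φ.toHomeomorph.toOpenPartialHomeomorph where
  mem_maximalAtlas := OpenPartialHomeomorph.mem_maximalAtlas_of_contMDiffOn _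
    Φ.contMDiff.contMDiffOn Φ.symm.contMDiff.contMDiffOn
  source_eq := rfl
  mem_target := fun _ _ => trivial
  rotation_invariant := fun ρ hρ y _ v w => by
    refine chartMetric_linear_of_isometry (φ := Φ.toHomeomorph.toOpenPartialHomeomorph)
      (τ := fun x => Φ.symm (ρ (Φ x)))
      (OpenPartialHomeomorph.mem_maximalAtlas_of_contMDiffOn _
        Φ.contMDiff.contMDiffOn Φ.symm.contMDiff.contMDiffOn) ?_
      (hsym _ ⟨ρ, hρ, fun _ => rfl⟩) ρ (fun _ _ => trivial) (fun y _ => ?_) trivial v w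
    · exact (Φ.symm.contMDiff.comp (ρ.contDiff.contMDiff.comp Φ.contMDiff)).mdifferentiable
        (by simp)
    · exact congrArg (fun z => Φ.symm (ρ z)) (Φ.apply_symm_apply y).symm

lemma cylinderChart_mem_maximalAtlas
    (Φ : M ≃ₘ⟮𝓡 (n + 1), 𝓘(ℝ, ℝ).prod (𝓡 n)⟯ (ℝ × Sph n)) :
    cylinderChart Φ ∈ IsManifold.maximalAtlas (𝓡 (n + 1)) ∞ M := by
  refine OpenPartialHomeomorph.mem_maximalAtlas_of_contMDiffOn _ ?_ ?_
  · have h1 : ContMDiff (𝓡 (n + 1)) 𝓘(ℝ, ℝ) ∞ fun x => Real.exp (Φ x).1 :=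
      Real.contDiff_exp.contMDiff.comp (contMDiff_fst.comp Φ.contMDiff)
    have h2 : ContMDiff (𝓡 (n + 1)) 𝓘(ℝ, Euc (n + 1)) ∞ fun x => ((Φ x).2 : Euc (n + 1)) :=
      contMDiff_coe_sphere.comp (contMDiff_snd.comp Φ.contMDiff)
    exact (h1.smul h2).contMDiffOn
  · refine Φ.symm.contMDiff.comp_contMDiffOn (ContMDiffOn.prodMk ?_ (contMDiffOn_toSphere n))
    intro y hy
    have h0 : y ≠ 0 := hy
    have h2 : ContDiffAt ℝ ∞ (fun z : Euc (n + 1) => Real.log ‖z‖) y :=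
      (contDiffAt_norm ℝ h0).log (norm_ne_zero_iff.2 h0)
    exact h2.contMDiffAt.contMDiffWithinAt

lemma StandardModel.SymmetricMetric.isRotationalChart_cylinder
    {Φ : M ≃ₘ⟮𝓡 (n + 1), 𝓘(ℝ, ℝ).prod (𝓡 n)⟯ (ℝ × Sph n)}
    (hsym : (StandardModel.cylinder Φ).SymmetricMetric g) :
    IsRotationalChart g (cylinderChart Φ) where
  mem_maximalAtlas := cylinderChart_mem_maximalAtlas Φ
  source_eq := rfl
  mem_target := fun _ hy => hy
  rotation_invariant := fun ρ hρ y hy v w => by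
    refine chartMetric_linear_of_isometry
      (τ := fun x => Φ.symm ((Φ x).1, sphereMap ρ (Φ x).2)) (cylinderChart_mem_maximalAtlas Φ) ?_
      (hsym _ ⟨ρ, hρ, fun _ => rfl⟩) ρ ?_
      (fun y hy => cylinderChart_symm_rotation Φ ρ hy) hy v w
    · exact (Φ.symm.contMDiff.comp ((contMDiff_fst.comp Φ.contMDiff).prodMk
        ((contMDiff_sphereMap ρ).comp (contMDiff_snd.comp Φ.contMDiff)))).mdifferentiable (by simp)
    · intro z hz
      have hz0 : z ≠ 0 := hz
      exact fun h => hz0 (by simpa using h)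

lemma sphereChart_mem_maximalAtlas (Φ : M ≃ₘ⟮𝓡 (n + 1), 𝓡 (n + 1)⟯ Sph (n + 1))
    (q : Sph (n + 1)) : sphereChart Φ q ∈ IsManifold.maximalAtlas (𝓡 (n + 1)) ∞ M := by
  refine OpenPartialHomeomorph.mem_maximalAtlas_of_contMDiffOn _ ?_ ?_
  · exact contMDiffOn_chart.comp Φ.contMDiff.contMDiffOn fun x hx => hx
  · exact Φ.symm.contMDiff.comp_contMDiffOn contMDiffOn_chart_symm

/-- On the sphere, the potential of a soliton with symmetric metric is symmetric: its change under
a rotation has vanishing Hessian and attains its maximum, so it is constant, and the constant is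
zero since the potential is bounded. -/
lemma StandardModel.symmetricFunction_sphere {Φ : M ≃ₘ⟮𝓡 (n + 1), 𝓡 (n + 1)⟯ Sph (n + 1)}
    (hsym : (StandardModel.sphere Φ).SymmetricMetric g) {f : M → ℝ} {lam : ℝ}
    (hsol : IsShrinkingSoliton g f lam) : (StandardModel.sphere Φ).SymmetricFunction f := by
  rintro τ ⟨ρ, hρ, hρe, hτ⟩ x₀
  have hinf := infinite_sphere n
  have hτ' : τ = fun x => Φ.symm (sphereMap ρ (Φ x)) := funext hτ
  have hτs : ContMDiff (𝓡 (n + 1)) (𝓡 (n + 1)) ∞ τ := by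
    rw [hτ']
    exact Φ.symm.contMDiff.comp ((contMDiff_sphereMap ρ).comp Φ.contMDiff)
  have : CompactSpace M := Φ.toHomeomorph.symm.compactSpace
  have : Nonempty M := ⟨x₀⟩
  have hf : Continuous f := hsol.smooth.continuous
  obtain ⟨x₁, -, h₁⟩ := isCompact_univ.exists_isMaxOn Set.univ_nonempty hf.continuousOn
  obtain ⟨x₂, -, h₂⟩ := isCompact_univ.exists_isMinOn Set.univ_nonempty hf.continuousOn
  obtain ⟨x₃, -, h₃⟩ := isCompact_univ.exists_isMaxOn Set.univ_nonempty
    ((hf.comp hτs.continuous).sub hf).continuousOn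
  -- A stereographic projection defined at the four points involved.
  obtain ⟨p, hp⟩ := Infinite.exists_notMem_finset ({Φ x₀, Φ x₁, Φ x₂, Φ x₃} : Finset (Sph (n + 1)))
  simp only [Finset.mem_insert, Finset.mem_singleton, not_or] at hp
  have hsource : ∀ x, p ≠ Φ x → x ∈ (sphereChart Φ (-p)).source :=
    fun x hx => mem_sphereChart_source (by rw [neg_neg]; exact hx.symm)
  set φ := sphereChart Φ (-p) with hφdef
  -- The chart `φ ∘ τ⁻¹`, in which the metric has the same coefficients.
  let ψ := sphereChart (Φ.trans (sphereDiffeomorph ρ.symm)) (-p)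
  have hφ := sphereChart_mem_maximalAtlas Φ (-p)
  have htarget : φ.target = Set.univ := sphereChart_target _ _
  have hψφ : ∀ y, ψ.symm y = τ (φ.symm y) := by
    intro y
    rw [hτ']
    change Φ.symm (sphereMap ρ ((chartAt (Euc (n + 1)) (-p)).symm y)) =
      Φ.symm (sphereMap ρ (Φ (Φ.symm ((chartAt (Euc (n + 1)) (-p)).symm y))))
    rw [Φ.apply_symm_apply]
  have hK : IsParallel g φ (fun y => f (ψ.symm y) - f (φ.symm y)) := by
    refine hsol.isParallel_sub hφ (sphereChart_mem_maximalAtlas _ _)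
      ((sphereChart_target _ _).trans htarget.symm) fun y hy i j => ?_
    exact chartMetric_eq_of_isometry g hφ (hτs.mdifferentiable (by simp))
      (hsym τ ⟨ρ, hρ, hρe, hτ⟩) (fun y _ => hψφ y) hy _ _
  simp only [hψφ] at hK
  have hcrit : fderiv ℝ (fun y => f (τ (φ.symm y)) - f (φ.symm y)) (φ x₃) = 0 := by
    refine IsLocalMax.fderiv_eq_zero (Filter.Eventually.of_forall fun y => ?_)
    simp only [φ.left_inv (hsource x₃ hp.2.2.2)]
    exact h₃ (Set.mem_univ (φ.symm y))
  have hconst : ∀ x, p ≠ Φ x → f (τ x) - f x = f (τ x₀) - f x₀ := by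
    intro x hx
    have := hK.eq_of_fderiv_eq_zero hφ (htarget ▸ isPreconnected_univ)
      (htarget ▸ Set.mem_univ _) hcrit (y := φ x) (z := φ x₀) (htarget ▸ Set.mem_univ _)
      (htarget ▸ Set.mem_univ _)
    simpa only [φ.left_inv (hsource x hx), φ.left_inv (hsource x₀ hp.1)] using this
  -- The constant is at most zero at the maximum of `f` and at least zero at its minimum.
  have e₁ : f (τ x₁) ≤ f x₁ := h₁ (Set.mem_univ (τ x₁))
  have e₂ : f x₂ ≤ f (τ x₂) := h₂ (Set.mem_univ (τ x₂))
  linarith [hconst x₁ hp.2.1, hconst x₂ hp.2.2.1]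

end Models

end

theorem mainTheorem3 (n : ℕ) (hn : 2 ≤ n)
    {M : Type*} [TopologicalSpace M] [ChartedSpace (Euc (n + 1)) M] [IsManifold (𝓡 (n + 1)) ∞ M]
    (S : StandardModel n M) (g : SmoothMetric (n + 1) M) (f : M → ℝ) (lam : ℝ)
    (hcomplete : IsCompleteMetric g) (hsym : S.SymmetricMetric g)
    (hsoliton : IsShrinkingSoliton g f lam)
    (hf : ¬ S.SymmetricFunction f) :
    (∃ Φ : M ≃ₘ⟮𝓡 (n + 1), 𝓡 (n + 1)⟯ Euc (n + 1), S = .euclidean Φ) ∧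
      IsometricToEuclidean g := by
  have hm : 3 ≤ n + 1 := by omega
  cases S with
  | sphere Φ => exact absurd (StandardModel.symmetricFunction_sphere hsym hsoliton) hf
  | cylinder Φ =>
    exfalso
    simp only [StandardModel.SymmetricFunction, not_forall] at hf
    obtain ⟨τ, ⟨ρ, hρ, hτ⟩, x, hx⟩ := hf
    have hφ := hsym.isRotationalChart_cylinder
    have hy : cylinderChart Φ x ∈ (cylinderChart Φ).target :=
      (cylinderChart Φ).map_source (Set.mem_univ x)
    obtain ⟨u, H, hH⟩ := hφ.exists_isOddParallel hm hsoliton (ρ := ρ) hy (by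
      rw [cylinderChart_symm_rotation Φ ρ hy, (cylinderChart Φ).left_inv (Set.mem_univ x), ← hτ]
      exact hx)
    exact hφ.false_of_isOddParallel hm hcomplete (fun h => h rfl) hH
  | euclidean Φ =>
    refine ⟨⟨Φ, rfl⟩, ?_⟩
    simp only [StandardModel.SymmetricFunction, not_forall] at hf
    obtain ⟨τ, ⟨ρ, hρ, hτ⟩, x, hx⟩ := hf
    have hφ := hsym.isRotationalChart_euclidean
    set φ := Φ.toHomeomorph.toOpenPartialHomeomorph
    obtain ⟨u, H, hH⟩ := hφ.exists_isOddParallel hm hsoliton (ρ := ρ) (y := φ x) trivial (by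
      rw [φ.left_inv (Set.mem_univ x)]
      rw [hτ] at hx
      exact hx)
    obtain ⟨Ψ, hΨ⟩ := hφ.exists_isometry hm hcomplete rfl hH
    refine ⟨Φ.trans Ψ, fun x u v => ?_⟩
    have hcomp : ∀ w : TangentSpace (𝓡 (n + 1)) x,
        mfderiv (𝓡 (n + 1)) (𝓡 (n + 1)) (Φ.trans Ψ) x w =
          fderiv ℝ Ψ (Φ x) (mfderiv (𝓡 (n + 1)) (𝓡 (n + 1)) Φ x w) := by
      intro w
      have h1 : mfderiv (𝓡 (n + 1)) (𝓡 (n + 1)) (Φ.trans Ψ) x = _ :=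
        mfderiv_comp (g := Ψ) (f := Φ) (I' := 𝓡 (n + 1)) x
          (Ψ.contMDiff.mdifferentiable (by simp) (Φ x))
          (Φ.contMDiff.mdifferentiable (by simp) x)
      rw [h1, mfderiv_eq_fderiv]
      rfl
    rw [inner_eq_chartMetric g hφ.mem_maximalAtlas (Set.mem_univ x)]
    refine (hΨ _ _ _).trans ?_
    exact congrArg₂ (fun a b : Euc (n + 1) => inner ℝ a b) (hcomp u).symm (hcomp v).symm
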